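/- Let $d\in\mathbb N$, $\sigma_a,\sigma_A>0$, $\sigma_b\ge 0$. Let $\mathbb X$ be the space of continuous paths $x:[0,1]\to\mathbb R^d$ with $x(0)=0$ that have a square integrable derivative $\dot x\in L^2([0,1];\mathbb R^d)$, i.e. $x_t=\int_0^t\dot x_s\,ds$. On a probability space, for every width $N$ let $a\in\mathbb R^N$, $A_1,\dots,A_d\in\mathbb R^{N\times N}$ and $b_1,\dots,b_d\in\mathbb R^N$ be random with independent entries $[a]_\alpha\sim\mathcal N(0,\sigma_a^2)$, $[A_k]_\alpha^\beta\sim\mathcal N(0,\sigma_A^2/N)$, $[b_k]_\alpha\sim\mathcal N(0,\sigma_b^2)$. For $x\in\mathbb X$ let $S^N(x)$ be the randomized signature with activation $\varphi=\mathrm{id}$, i.e. the unique continuous solution on $[0,1]$ of the neural CDE $$S^N_t(x)=a+\sum_{k=1}^d\int_0^t\big(A_kS^N_\tau(x)+b_k\big)\,dx^k_\tau .$$ For $\varphi:\mathbb R\to\mathbb R$ and a positive semidefinite $\Sigma\in\mathbb R^{2\times2}$ put $V_\varphi(\Sigma)=\mathbb E_{Z\sim\mathcal N(0,\Sigma)}[\varphi(Z_1)\varphi(Z_2)]$.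 The identity neural signature kernel $\mathcal K_{\mathrm{id}}=(\mathcal K_{\mathrm{id}}^{x,y})_{x,y\in\mathbb X}$ is the solution, with $\varphi=\mathrm{id}$, of $$\mathcal K_\varphi^{x,y}(s,t)=\sigma_a^2+\int_0^s\!\!\int_0^t\Big[\sigma_A^2V_\varphi\big(\Sigma_\varphi^{x,y}(\eta,\tau)\big)+\sigma_b^2\Big]\langle\dot x_\eta,\dot y_\tau\rangle_{\mathbb R^d}\,d\tau\,d\eta,\qquad \Sigma_\varphi^{x,y}(s,t)=\begin{pmatrix}\mathcal K_\varphi^{x,x}(s,s)&\mathcal K_\varphi^{x,y}(s,t)\\ \mathcal K_\varphi^{x,y}(s,t)&\mathcal K_\varphi^{y,y}(t,t)\end{pmatrix},$$ for $x,y\in\mathbb X$ and $s,t\in[0,1]$, where each $\mathcal K_\varphi^{x,y}$ is continuous on $[0,1]^2$ and each $\Sigma_\varphi^{x,y}(s,t)$ is positive semidefinite. **Theorem.** For $\varphi=\mathrm{id}$ the neural CDE and the kernel equation are well posed (they have exactly one such solution), and for all $x,y\in\mathbb X$ and $s,t\in[0,1]$ the variables $\frac1N\langle S^N_s(x),S^N_t(y)\rangle_{\mathbb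 R^N}$ are square integrable and $$\frac1N\langle S^N_s(x),S^N_t(y)\rangle_{\mathbb R^N}\ \xrightarrow[N\to\infty]{L^2}\ \mathcal K_{\mathrm{id}}^{x,y}(s,t).$$ Moreover the convergence is of order $O(1/N)$ in mean square: there is a constant $C$, not depending on $N$, such that for all $N\ge1$ $$\mathbb E\Big[\Big(\tfrac1N\langle S^N_s(x),S^N_t(y)\rangle_{\mathbb R^N}-\mathcal K_{\mathrm{id}}^{x,y}(s,t)\Big)^2\Big]\le\frac CN .$$ -/

import Mathlib

open MeasureTheory ProbabilityTheory Filter Topology Set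
open scoped Matrix

namespace NeuralSig

noncomputable section

/-- `x'` is a square integrable derivative on `[0,1]` of the path `x` started at the origin:
`x' ∈ L²([0,1]; ℝᵈ)` and `x_t = ∫₀ᵗ x'_s ds`. -/
def HasL2Deriv {d : ℕ} (x : C(unitInterval, EuclideanSpace ℝ (Fin d)))
    (x' : ℝ → EuclideanSpace ℝ (Fin d)) : Prop :=
  MemLp x' 2 (volume.restrict (Icc (0 : ℝ) 1)) ∧
    ∀ t : unitInterval, x t = ∫ s in (0 : ℝ)..(t : ℝ), x' s

/-- The space `𝕏` of continuous paths `x : [0,1] → ℝᵈ` with `x(0) = 0` that have a square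
integrable derivative. -/
def PathSpace (d : ℕ) : Type :=
  {x : C(unitInterval, EuclideanSpace ℝ (Fin d)) // ∃ x', HasL2Deriv x x'}

/-- The derivative `ẋ` of a path (a representative of it; it is unique almost everywhere
on `[0,1]`). -/
def PathSpace.deriv {d : ℕ} (x : PathSpace d) : ℝ → EuclideanSpace ℝ (Fin d) :=
  Classical.choose x.2

/-- Initial condition `a ∈ ℝᴺ`, matrices `A_k ∈ ℝᴺˣᴺ` and biases `b_k ∈ ℝᴺ`, `k = 1, …, d`. -/
structure Weights (N d : ℕ) where
  a : EuclideanSpace ℝ (Fin N)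
  A : Fin d → Matrix (Fin N) (Fin N) ℝ
  b : Fin d → EuclideanSpace ℝ (Fin N)

/-- All scalar entries of the weights, as one family. -/
def Weights.entry {N d : ℕ} (W : Weights N d) :
    Fin N ⊕ (Fin d × Fin N × Fin N) ⊕ (Fin d × Fin N) → ℝ
  | .inl α => W.a α
  | .inr (.inl (k, α, β)) => W.A k α β
  | .inr (.inr (k, α)) => W.b k α

/-- The Gaussian initialisation of a network of width `N`: all the entries are independent with
`[a]_α ∼ 𝒩(0, σa²)`, `[A_k]_α^β ∼ 𝒩(0, σA²/N)` and `[b_k]_α ∼ 𝒩(0, σb²)`. -/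
structure IsGaussianInit {Ω : Type*} [MeasurableSpace Ω] (P : Measure Ω) (σa σA σb : ℝ)
    {N d : ℕ} (W : Ω → Weights N d) : Prop where
  law_a : ∀ α, HasLaw (fun ω => (W ω).a α) (gaussianReal 0 (σa ^ 2).toNNReal) P
  law_A : ∀ k α β,
    HasLaw (fun ω => (W ω).A k α β) (gaussianReal 0 (σA ^ 2 / (N : ℝ)).toNNReal) P
  law_b : ∀ k α, HasLaw (fun ω => (W ω).b k α) (gaussianReal 0 (σb ^ 2).toNNReal) P
  indep : iIndepFun (fun e ω => (W ω).entry e) P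

/-- `S` is a (continuous) solution on `[0,1]` of the neural CDE
`S_t = a + ∑ₖ ∫₀ᵗ (A_k φ(S_τ) + b_k) dxᵏ_τ`, with `φ` acting componentwise and
`dxᵏ_τ = ẋᵏ_τ dτ`. -/
def IsNeuralCDESol (φ : ℝ → ℝ) {N d : ℕ} (W : Weights N d) (x : PathSpace d)
    (S : ℝ → EuclideanSpace ℝ (Fin N)) : Prop :=
  ContinuousOn S (Icc 0 1) ∧
    ∀ t ∈ Icc (0 : ℝ) 1,
      S t = W.a + ∑ k : Fin d, ∫ τ in (0 : ℝ)..t,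
        x.deriv τ k • (WithLp.toLp 2 (W.A k *ᵥ fun α => φ (S τ α)) + W.b k)

/-- The randomized signature `Sᴺ(x)`: the solution of the neural CDE. -/
def randSig (φ : ℝ → ℝ) {N d : ℕ} (W : Weights N d) (x : PathSpace d) :
    ℝ → EuclideanSpace ℝ (Fin N) :=
  Classical.epsilon (IsNeuralCDESol φ W x)

/-- `V_φ(Σ) = 𝔼[φ(Z₁) φ(Z₂)]` with `(Z₁, Z₂) ∼ 𝒩(0, Σ)`. -/
def V (φ : ℝ → ℝ) (Sig : Matrix (Fin 2) (Fin 2) ℝ) : ℝ :=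
  ∫ z, φ (z 0) * φ (z 1) ∂(multivariateGaussian (0 : EuclideanSpace ℝ (Fin 2)) Sig)

/-- The matrix `Σ^{x,y}(s,t)` attached to a family `K` of two-parameter functions. -/
def covMat {d : ℕ} (K : PathSpace d → PathSpace d → ℝ → ℝ → ℝ) (x y : PathSpace d)
    (s t : ℝ) : Matrix (Fin 2) (Fin 2) ℝ :=
  !![K x x s s, K x y s t; K x y s t, K y y t t]

/-- `K = (K^{x,y})` is a solution of the equation of the neural signature kernel: for all paths
`x, y`, `K^{x,y}` is continuous on `[0,1]²`, the matrices `Σ^{x,y}(s,t)` are positive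
semidefinite (so that `V_φ(Σ^{x,y}(s,t))` makes sense), and
`K^{x,y}(s,t) = σa² + ∫₀ˢ ∫₀ᵗ [σA² V_φ(Σ^{x,y}(η,τ)) + σb²] ⟨ẋ_η, ẏ_τ⟩ dτ dη`. -/
structure IsNeuralSigKernel (φ : ℝ → ℝ) (σa σA σb : ℝ) {d : ℕ}
    (K : PathSpace d → PathSpace d → ℝ → ℝ → ℝ) : Prop where
  continuousOn : ∀ x y,
    ContinuousOn (fun p : ℝ × ℝ => K x y p.1 p.2) (Icc 0 1 ×ˢ Icc 0 1)
  posSemidef : ∀ x y, ∀ s ∈ Icc (0 : ℝ) 1, ∀ t ∈ Icc (0 : ℝ) 1, (covMat K x y s t).PosSemidef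
  eq : ∀ x y, ∀ s ∈ Icc (0 : ℝ) 1, ∀ t ∈ Icc (0 : ℝ) 1,
    K x y s t = σa ^ 2 + ∫ η in (0 : ℝ)..s, ∫ τ in (0 : ℝ)..t,
      (σA ^ 2 * V φ (covMat K x y η τ) + σb ^ 2) * inner ℝ (x.deriv η) (y.deriv τ)

/-- The neural signature kernel `𝒦_φ^{x,y}(s,t)`: the solution of its equation. -/
def neuralSigKernel (φ : ℝ → ℝ) (σa σA σb : ℝ) {d : ℕ} :
    PathSpace d → PathSpace d → ℝ → ℝ → ℝ :=
  Classical.epsilon (IsNeuralSigKernel φ σa σA σb)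

end

end NeuralSig

namespace NeuralSig

noncomputable section

/-! For `φ = id` everything is linear. Picard iteration of the CDE gives `S_t = ∑ I_{w,c}(t) A_w c`,
summed over words `w` and sources `c` (the initial vector or a bias), with iterated integrals
`I_{w,c}`. Since `V_id(Σ)` is the off-diagonal entry of `Σ` (`V_id`), the kernel equation is linear
too, solved by `∑ σA^(2|w|) var(c) I^x_{w,c}(s) I^y_{w,c}(t)`. Factorial decay of iterated integrals
makes both series converge, and iterating the integral inequality for a difference of two solutions
gives uniqueness.

The error is therefore a double series over pairs of nodes: iterated integrals times the deviation
of `(1/N)⟨A_v c, A_w c'⟩` from its limit, which is nonzero only on the diagonal (`hasSum_gramDev`).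
If each deviation has second moment at most `C^(|v|+|w|) |v|! |w|! / N`, then, as the squared
integrals decay like `1/(|v|! |w|!)^2`, the `L²` norms of the terms are summable even over `d^n`
words of each length `n`, and the sum is of order `N^(-1/2)` (`memLp_two_of_hasSum`).

The moment bound is Gaussian integration by parts. Wick's formula in the sources reduces the second
moment to expectations of products of normalised traces of words in the `A_k` and their transposes
(`IsWick.map_quadForm_sq`). Stein's identity on the first letter pairs it with each other letter:
with its transpose inside the same trace, it splits the trace in two at no cost; any other pairing
costs at least `1/N`. Hence products of traces factorise up to `O(1/N)`, with limits that count
noncrossing pairings and constants that grow like a double factorial (`IsWick.abs_map_prodTr_le`).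
For `A_vᵀ A_w` only the nested pairing can contribute, and it exists exactly when `v = w`
(`limTr_pairWord`). -/

/-! ### Picard iteration and Grönwall estimates with an integrable weight -/

/-- The powers of a primitive `G` of `g` satisfy `∫₀ᵗ g Gⁿ = Gⁿ⁺¹ / (n + 1)`. -/
theorem integral_mul_primitive_pow {g : ℝ → ℝ} (hg : Integrable g) (n : ℕ) (t : ℝ) :
    ∫ τ in (0 : ℝ)..t, g τ * (∫ r in (0 : ℝ)..τ, g r) ^ n =
      (∫ r in (0 : ℝ)..t, g r) ^ (n + 1) / (n + 1) := by
  set G : ℝ → ℝ := fun τ => ∫ r in (0 : ℝ)..τ, g r with hG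
  -- As `g` is merely integrable, `G` need not be differentiable everywhere; absolute continuity of
  -- its powers replaces the classical fundamental theorem of calculus.
  have hac : AbsolutelyContinuousOnInterval G 0 t :=
    hg.intervalIntegrable.absolutelyContinuousOnInterval_intervalIntegral (by simp)
  have hpow : ∀ m : ℕ, AbsolutelyContinuousOnInterval (fun τ => G τ ^ (m + 1)) 0 t := by
    intro m
    induction m with
    | zero => simpa using hac
    | succ m ih => simpa [pow_succ] using ih.fun_mul hac
  have h := (hpow n).integral_deriv_eq_sub
  have hcongr : ∫ x in (0 : ℝ)..t, deriv (fun τ => G τ ^ (n + 1)) x =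
      ∫ x in (0 : ℝ)..t, ((n : ℝ) + 1) * (g x * G x ^ n) := by
    apply intervalIntegral.integral_congr_ae
    filter_upwards [(hg.intervalIntegrable (a := 0) (b := t)).ae_hasDerivAt_integral]
      with x hx hx'
    have := (hx (uIoc_subset_uIcc hx') 0 (by simp)).pow (n + 1)
    refine this.deriv.trans ?_
    simp only [Nat.add_sub_cancel, hG]
    push_cast
    ring
  rw [hcongr, intervalIntegral.integral_const_mul] at h
  have hn : (n : ℝ) + 1 ≠ 0 := by positivity
  have h0 : G 0 = 0 := by simp [hG]
  simp only [h0, ne_eq, Nat.add_eq_zero_iff, one_ne_zero, and_false, not_false_eq_true, zero_pow,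
    sub_zero] at h
  rw [eq_div_iff hn, mul_comm]
  exact h

theorem integral_mul_primitive_pow_div_factorial {g : ℝ → ℝ} (hg : Integrable g) (n : ℕ) (t : ℝ) :
    ∫ τ in (0 : ℝ)..t, g τ * ((∫ r in (0 : ℝ)..τ, g r) ^ n / n.factorial) =
      (∫ r in (0 : ℝ)..t, g r) ^ (n + 1) / (n + 1).factorial := by
  simp_rw [← mul_div_assoc, intervalIntegral.integral_div, integral_mul_primitive_pow hg]
  rw [Nat.factorial_succ]
  push_cast
  field_simp

theorem continuous_primitive_of_integrable {g : ℝ → ℝ} (hg : Integrable g) :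
    Continuous fun t => ∫ τ in (0 : ℝ)..t, g τ :=
  intervalIntegral.continuous_primitive (fun _ _ => hg.intervalIntegrable) 0

theorem intervalIntegrable_mul_primitive_pow {g : ℝ → ℝ} (hg : Integrable g) (n : ℕ) (s t C : ℝ) :
    IntervalIntegrable (fun τ => g τ * (C * ((∫ r in (0 : ℝ)..τ, g r) ^ n / n.factorial)))
      volume s t :=
  hg.intervalIntegrable.mul_continuousOn
    (((continuous_primitive_of_integrable hg).pow n).div_const _ |>.const_mul C).continuousOn

theorem primitive_nonneg {g : ℝ → ℝ} (h0 : ∀ τ, 0 ≤ g τ) {t : ℝ} (ht : 0 ≤ t) :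
    0 ≤ ∫ τ in (0 : ℝ)..t, g τ :=
  intervalIntegral.integral_nonneg ht fun τ _ => h0 τ

theorem primitive_mono {g : ℝ → ℝ} (hg : Integrable g) (h0 : ∀ τ, 0 ≤ g τ) {s t : ℝ}
    (hst : s ≤ t) : ∫ τ in (0 : ℝ)..s, g τ ≤ ∫ τ in (0 : ℝ)..t, g τ := by
  rw [← sub_nonneg, intervalIntegral.integral_interval_sub_left hg.intervalIntegrable
    hg.intervalIntegrable]
  exact intervalIntegral.integral_nonneg hst fun τ _ => h0 τ

theorem tendsto_const_mul_pow_div_factorial (M x : ℝ) :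
    Tendsto (fun n : ℕ => M * (x ^ n / n.factorial)) atTop (𝓝 0) := by
  simpa using (FloorSemiring.tendsto_pow_div_factorial_atTop x).const_mul M

/-- A step of Picard iteration: a bound by `Gⁿ / n!` of the integrand against `g` becomes one
by `Gⁿ⁺¹ / (n + 1)!`. -/
theorem norm_integral_le_pow_div_factorial {E : Type*} [NormedAddCommGroup E] [NormedSpace ℝ E]
    {g : ℝ → ℝ} (hg : Integrable g) {F : ℝ → E} {C : ℝ} {n : ℕ} {t : ℝ} (ht : 0 ≤ t)
    (hF : ∀ τ ∈ Icc 0 t, ‖F τ‖ ≤ g τ * (C * ((∫ r in (0 : ℝ)..τ, g r) ^ n / n.factorial))) :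
    ‖∫ τ in (0 : ℝ)..t, F τ‖ ≤
      C * ((∫ r in (0 : ℝ)..t, g r) ^ (n + 1) / (n + 1).factorial) := by
  refine (intervalIntegral.norm_integral_le_of_norm_le ht
    (ae_of_all _ fun τ hτ => hF τ (Ioc_subset_Icc_self hτ))
    (intervalIntegrable_mul_primitive_pow hg n 0 t C)).trans_eq ?_
  rw [← integral_mul_primitive_pow_div_factorial hg, ← intervalIntegral.integral_const_mul]
  congr 1
  ext τ
  ring

/-- Grönwall's lemma in the form used for uniqueness: a bounded function dominated by its own
integral against an integrable weight vanishes. -/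
theorem eq_zero_of_norm_le_integral {E : Type*} [NormedAddCommGroup E] [NormedSpace ℝ E]
    {g : ℝ → ℝ} (hg : Integrable g) {D : ℝ → E} {F : ℝ → ℝ → E} {M : ℝ}
    (hM : ∀ t ∈ Icc (0 : ℝ) 1, ‖D t‖ ≤ M)
    (hD : ∀ t ∈ Icc (0 : ℝ) 1, D t = ∫ τ in (0 : ℝ)..t, F t τ)
    (hF : ∀ t ∈ Icc (0 : ℝ) 1, ∀ τ ∈ Icc 0 t, ‖F t τ‖ ≤ g τ * ‖D τ‖)
    (h0 : ∀ τ, 0 ≤ g τ) :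
    ∀ t ∈ Icc (0 : ℝ) 1, D t = 0 := by
  have key : ∀ n : ℕ, ∀ t ∈ Icc (0 : ℝ) 1,
      ‖D t‖ ≤ M * ((∫ r in (0 : ℝ)..t, g r) ^ n / n.factorial) := by
    intro n
    induction n with
    | zero => simpa using hM
    | succ n ih =>
      intro t ht
      rw [hD t ht]
      exact norm_integral_le_pow_div_factorial hg ht.1 fun τ hτ => (hF t ht τ hτ).trans
        (mul_le_mul_of_nonneg_left (ih τ ⟨hτ.1, hτ.2.trans ht.2⟩) (h0 τ))
  intro t ht
  rw [← norm_le_zero_iff]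
  exact ge_of_tendsto' (tendsto_const_mul_pow_div_factorial M _) fun n => key n t ht

/-- The Grönwall lemma for functions of two variables. -/
theorem eq_zero_of_norm_le_integral_integral {g h : ℝ → ℝ} (hg : Integrable g) (hh : Integrable h)
    {D : ℝ → ℝ → ℝ} {F : ℝ → ℝ → ℝ} {M : ℝ}
    (hM : ∀ s ∈ Icc (0 : ℝ) 1, ∀ t ∈ Icc (0 : ℝ) 1, ‖D s t‖ ≤ M)
    (hD : ∀ s ∈ Icc (0 : ℝ) 1, ∀ t ∈ Icc (0 : ℝ) 1,
      D s t = ∫ η in (0 : ℝ)..s, ∫ τ in (0 : ℝ)..t, F η τ)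
    (hF : ∀ s ∈ Icc (0 : ℝ) 1, ∀ t ∈ Icc (0 : ℝ) 1, ‖F s t‖ ≤ g s * h t * ‖D s t‖)
    (h0 : ∀ τ, 0 ≤ g τ) (h0' : ∀ τ, 0 ≤ h τ) :
    ∀ s ∈ Icc (0 : ℝ) 1, ∀ t ∈ Icc (0 : ℝ) 1, D s t = 0 := by
  have key : ∀ n : ℕ, ∀ s ∈ Icc (0 : ℝ) 1, ∀ t ∈ Icc (0 : ℝ) 1,
      ‖D s t‖ ≤ M * ((∫ r in (0 : ℝ)..t, h r) ^ n / n.factorial) *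
        ((∫ r in (0 : ℝ)..s, g r) ^ n / n.factorial) := by
    intro n
    induction n with
    | zero => simpa using hM
    | succ n ih =>
      intro s hs t ht
      rw [hD s hs t ht]
      refine norm_integral_le_pow_div_factorial hg hs.1 fun η hη => ?_
      have hη' : η ∈ Icc (0 : ℝ) 1 := ⟨hη.1, hη.2.trans hs.2⟩
      -- The inner integral is estimated with `η` frozen, so its constant `C` absorbs `g η` and the
      -- power in the first variable; the outer estimate then integrates these.
      refine (norm_integral_le_pow_div_factorial (n := n)
        (C := g η * M * ((∫ r in (0 : ℝ)..η, g r) ^ n / n.factorial)) hh ht.1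
        fun τ hτ => ?_).trans_eq (by ring)
      have hτ' : τ ∈ Icc (0 : ℝ) 1 := ⟨hτ.1, hτ.2.trans ht.2⟩
      refine (hF η hη' τ hτ').trans ((mul_le_mul_of_nonneg_left (ih η hη' τ hτ')
        (mul_nonneg (h0 η) (h0' τ))).trans_eq (by ring))
  intro s hs t ht
  rw [← norm_le_zero_iff]
  have := ((tendsto_const_mul_pow_div_factorial M (∫ r in (0 : ℝ)..t, h r)).mul
    (FloorSemiring.tendsto_pow_div_factorial_atTop (∫ r in (0 : ℝ)..s, g r)))
  rw [zero_mul] at this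
  exact ge_of_tendsto' this fun n => key n s hs t ht

/-! ### Iterated integrals and summation over words -/

/-- The index set of the expansion of the randomized signature: a word and a source, which is
the initial condition (`none`) or one of the biases. -/
abbrev Node (d : ℕ) : Type := List (Fin d) × Option (Fin d)

/-- Iterated integrals of the differentials `uₖ dt`, the innermost one being that of the source. -/
def iterInt {d : ℕ} (u : Fin d → ℝ → ℝ) : List (Fin d) → Option (Fin d) → ℝ → ℝ
  | [], none => fun _ => 1
  | [], some k => fun t => ∫ τ in (0 : ℝ)..t, u k τ
  | k :: w, c => fun t => ∫ τ in (0 : ℝ)..t, u k τ * iterInt u w c τ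

section iterInt
variable {d : ℕ} {u : Fin d → ℝ → ℝ}

theorem continuous_iterInt (hu : ∀ k, Integrable (u k)) (w : List (Fin d)) (c : Option (Fin d)) :
    Continuous (iterInt u w c) := by
  induction w with
  | nil =>
    cases c with
    | none => exact continuous_const
    | some k => exact continuous_primitive_of_integrable (hu k)
  | cons k w ih =>
    exact intervalIntegral.continuous_primitive
      (fun _ _ => (hu k).intervalIntegrable.mul_continuousOn ih.continuousOn) 0

/-- The total variation density of the driving signal. -/
def speed (u : Fin d → ℝ → ℝ) (t : ℝ) : ℝ := ∑ k, |u k t|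

theorem speed_nonneg (u : Fin d → ℝ → ℝ) (t : ℝ) : 0 ≤ speed u t :=
  Finset.sum_nonneg fun _ _ => abs_nonneg _

theorem abs_le_speed (u : Fin d → ℝ → ℝ) (k : Fin d) (t : ℝ) : |u k t| ≤ speed u t :=
  Finset.single_le_sum (f := fun k => |u k t|) (fun _ _ => abs_nonneg _) (Finset.mem_univ k)

theorem integrable_speed (hu : ∀ k, Integrable (u k)) : Integrable (speed u) :=
  integrable_finsetSum _ fun k _ => (hu k).abs

/-- The length of the driving signal on `[0, 1]`. -/
def len (u : Fin d → ℝ → ℝ) : ℝ := ∫ t in (0 : ℝ)..1, speed u t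

theorem len_nonneg (u : Fin d → ℝ → ℝ) : 0 ≤ len u :=
  primitive_nonneg (speed_nonneg u) zero_le_one

/-- The factor `1 + len u` covers both sources at once: the constant `1` of the initial condition
and the innermost integral of a bias, which is at most `len u`. Each letter then contributes one
Picard step. -/
theorem abs_iterInt_le_primitive (hu : ∀ k, Integrable (u k)) (w : List (Fin d))
    (c : Option (Fin d)) {t : ℝ} (ht : t ∈ Icc (0 : ℝ) 1) :
    |iterInt u w c t| ≤
      (1 + len u) * ((∫ τ in (0 : ℝ)..t, speed u τ) ^ w.length / w.length.factorial) := by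
  induction w generalizing t with
  | nil =>
    have := len_nonneg u
    cases c with
    | none => simpa [iterInt] using this
    | some k =>
      have h : ‖∫ τ in (0 : ℝ)..t, u k τ‖ ≤ ∫ τ in (0 : ℝ)..t, speed u τ :=
        intervalIntegral.norm_integral_le_of_norm_le ht.1
          (ae_of_all _ fun τ _ => abs_le_speed u k τ) (integrable_speed hu).intervalIntegrable
      have h' := primitive_mono (integrable_speed hu) (speed_nonneg u) ht.2
      simp only [Real.norm_eq_abs] at h
      simp only [iterInt, List.length_nil, pow_zero, Nat.factorial_zero, Nat.cast_one, div_one,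
        mul_one]
      unfold len
      linarith
  | cons k w ih =>
    refine norm_integral_le_pow_div_factorial (F := fun τ => u k τ * iterInt u w c τ)
      (integrable_speed hu) ht.1 fun τ hτ => ?_
    rw [norm_mul]
    exact mul_le_mul (abs_le_speed u k τ) (ih ⟨hτ.1, hτ.2.trans ht.2⟩) (norm_nonneg _)
      (speed_nonneg u τ)

theorem abs_iterInt_le (hu : ∀ k, Integrable (u k)) (w : List (Fin d))
    (c : Option (Fin d)) {t : ℝ} (ht : t ∈ Icc (0 : ℝ) 1) :
    |iterInt u w c t| ≤ (1 + len u) * (len u ^ w.length / w.length.factorial) := by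
  refine (abs_iterInt_le_primitive hu w c ht).trans ?_
  have h0 := primitive_nonneg (speed_nonneg u) ht.1
  have h' := primitive_mono (integrable_speed hu) (speed_nonneg u) ht.2
  have := len_nonneg u
  gcongr
  exact h'

end iterInt

/-- There are `d ^ n` words of length `n`; summing over the fibres of the length reduces to a series
over `n`. -/
theorem summable_comp_length {d : ℕ} {a : ℕ → ℝ} (ha : ∀ n, 0 ≤ a n)
    (hs : Summable fun n => (d : ℝ) ^ n * a n) :
    Summable fun w : List (Fin d) => a w.length := by
  rw [← (Equiv.sigmaFiberEquiv (List.length (α := Fin d))).summable_iff]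
  have hcomp : ((fun w : List (Fin d) => a w.length) ∘ Equiv.sigmaFiberEquiv List.length) =
      fun p : (Σ n, {w : List (Fin d) // w.length = n}) => a p.1 := by
    ext ⟨n, w, rfl⟩
    rfl
  rw [hcomp, summable_sigma_of_nonneg fun p => ha _]
  have hcard : ∀ n, Nat.card {w : List (Fin d) // w.length = n} = d ^ n := fun n => by
    exact (Nat.card_eq_fintype_card (α := List.Vector (Fin d) n)).trans (by simp)
  have hfin : ∀ n, Finite {w : List (Fin d) // w.length = n} := fun n =>
    inferInstanceAs (Finite (List.Vector (Fin d) n))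
  refine ⟨fun n => ?_, ?_⟩
  · have := hfin n
    exact Summable.of_finite
  · refine hs.congr fun n => ?_
    simp only [tsum_const, hcard, nsmul_eq_mul, Nat.cast_pow]

theorem summable_comp_length_node {d : ℕ} {a : ℕ → ℝ} (ha : ∀ n, 0 ≤ a n)
    (hs : Summable fun n => (d : ℝ) ^ n * a n) :
    Summable fun j : Node d => a j.1.length := by
  rw [summable_prod_of_nonneg fun j => ha _]
  refine ⟨fun w => Summable.of_finite, ?_⟩
  simp only [tsum_const]
  exact (summable_comp_length ha hs).const_smul _

theorem summable_pow_div_factorial_node (d : ℕ) {x : ℝ} (hx : 0 ≤ x) :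
    Summable fun j : Node d => x ^ j.1.length / j.1.length.factorial := by
  refine summable_comp_length_node (a := fun n => x ^ n / n.factorial) (fun n => by positivity) ?_
  refine (Real.summable_pow_div_factorial (d * x)).congr fun n => ?_
  rw [mul_pow, mul_div_assoc]

/-- The square root of a factorial still beats `d ^ n`: writing the term as `((2dx)^n / √n!) ·
2^(-n)`, the inequality `2ab ≤ a² + b²` leaves an exponential series and a geometric one. The square
root appears because `L²` norms are summed while second moments are bounded. -/
theorem summable_pow_div_sqrt_factorial_node (d : ℕ) {x : ℝ} (hx : 0 ≤ x) :
    Summable fun j : Node d => x ^ j.1.length / √(j.1.length.factorial : ℝ) := by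
  refine summable_comp_length_node (a := fun n => x ^ n / √(n.factorial : ℝ))
    (fun n => by positivity) ?_
  refine Summable.of_nonneg_of_le (fun n => by positivity) (fun n => ?_)
    ((Real.summable_pow_div_factorial ((2 * d * x) ^ 2)).add
      (summable_geometric_of_lt_one (r := (1 / 4 : ℝ)) (by norm_num) (by norm_num)))
  have hf : (0 : ℝ) < n.factorial := by positivity
  have h := two_mul_le_add_sq ((2 * d * x) ^ n / √(n.factorial : ℝ)) ((1 / 2) ^ n)
  have h1 : (2 * d * x) ^ n / √(n.factorial : ℝ) * (1 / 2) ^ n =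
      (d : ℝ) ^ n * (x ^ n / √(n.factorial : ℝ)) := by
    have hp : (2 * d * x) ^ n * ((1 : ℝ) / 2) ^ n = (d : ℝ) ^ n * x ^ n := by
      rw [← mul_pow, ← mul_pow]
      congr 1
      ring
    rw [div_mul_eq_mul_div, hp, mul_div_assoc]
  have h2 : ((2 * d * x) ^ n / √(n.factorial : ℝ)) ^ 2 = ((2 * d * x) ^ 2) ^ n / n.factorial := by
    rw [div_pow, Real.sq_sqrt hf.le, ← pow_mul, ← pow_mul, mul_comm n 2]
  have h3 : (((1 : ℝ) / 2) ^ n) ^ 2 = (1 / 4) ^ n := by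
    rw [← pow_mul, mul_comm, pow_mul]
    norm_num
  rw [mul_assoc, h1, h2, h3] at h
  have : 0 ≤ (d : ℝ) ^ n * (x ^ n / √(n.factorial : ℝ)) := by positivity
  linarith

/-- A node is a source or a letter followed by a node. -/
def nodeEquiv (d : ℕ) : Option (Fin d) ⊕ (Fin d × Node d) ≃ Node d where
  toFun
    | .inl c => ([], c)
    | .inr (k, w, c) => (k :: w, c)
  invFun
    | ([], c) => .inl c
    | (k :: w, c) => .inr (k, w, c)
  left_inv := by rintro (c | ⟨k, w, c⟩) <;> rfl
  right_inv := by rintro ⟨_ | ⟨k, w⟩, c⟩ <;> rfl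

/-- Cutting off the first letter: this is what turns an expansion over nodes into the integral
equation that it solves. -/
theorem hasSum_node {E : Type*} [NormedAddCommGroup E] [CompleteSpace E] {d : ℕ}
    {f : Node d → E} {s : Fin d → E}
    (h : ∀ k, HasSum (fun j : Node d => f (k :: j.1, j.2)) (s k))
    (hs : Summable fun j => ‖f j‖) :
    HasSum f (∑ c, f ([], c) + ∑ k, s k) := by
  rw [← (nodeEquiv d).hasSum_iff]
  refine HasSum.sum (hasSum_fintype _) ?_
  have hsum : Summable fun p : Fin d × Node d => f (p.1 :: p.2.1, p.2.2) :=
    (hs.of_norm).comp_injective (i := fun p : Fin d × Node d => ((p.1 :: p.2.1, p.2.2) : Node d))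
      (by rintro ⟨k, w, c⟩ ⟨k', w', c'⟩ h; simpa [and_assoc] using h)
  have := hsum.hasSum.prod_fiberwise h
  rw [(hasSum_fintype s).unique this]
  exact hsum.hasSum

/-! ### The linear neural CDE: expansion and uniqueness -/

/-- The derivative of the `k`-th coordinate of a path, extended by zero outside of `(0, 1]`. -/
def vel {d : ℕ} (x : PathSpace d) (k : Fin d) : ℝ → ℝ :=
  (Ioc (0 : ℝ) 1).indicator fun τ => x.deriv τ k

theorem vel_eq {d : ℕ} (x : PathSpace d) (k : Fin d) {τ : ℝ} (hτ : τ ∈ Ioc (0 : ℝ) 1) :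
    vel x k τ = x.deriv τ k :=
  indicator_of_mem hτ _

/-- On an interval of finite length `L²` is contained in `L¹`; the rest of the argument on paths
uses integrability only. -/
theorem integrable_vel {d : ℕ} (x : PathSpace d) (k : Fin d) : Integrable (vel x k) := by
  have h : MemLp x.deriv 2 (volume.restrict (Icc (0 : ℝ) 1)) := (Classical.choose_spec x.2).1
  have h1 : IntegrableOn x.deriv (Icc (0 : ℝ) 1) := h.integrable one_le_two
  have h2 : IntegrableOn x.deriv (Ioc (0 : ℝ) 1) := h1.mono_set Ioc_subset_Icc_self
  rw [vel, integrable_indicator_iff measurableSet_Ioc]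
  exact (EuclideanSpace.proj (𝕜 := ℝ) k).integrable_comp h2

section CDE
variable {N d : ℕ}

/-- The initial condition and the biases as one family. -/
def Weights.src (W : Weights N d) (c : Option (Fin d)) : EuclideanSpace ℝ (Fin N) :=
  c.elim W.a W.b

/-- The matrix `A_k` as an operator. -/
def Weights.op (W : Weights N d) (k : Fin d) :
    EuclideanSpace ℝ (Fin N) →L[ℝ] EuclideanSpace ℝ (Fin N) :=
  Matrix.toEuclideanCLM (𝕜 := ℝ) (W.A k)

theorem Weights.op_apply (W : Weights N d) (k : Fin d) (v : EuclideanSpace ℝ (Fin N)) :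
    W.op k v = WithLp.toLp 2 (W.A k *ᵥ fun α => id (v α)) :=
  rfl

/-- The product of the matrices of a word, applied to a source. -/
def Weights.nodeVec (W : Weights N d) : List (Fin d) → Option (Fin d) → EuclideanSpace ℝ (Fin N)
  | [], c => W.src c
  | k :: w, c => W.op k (W.nodeVec w c)

theorem Weights.norm_nodeVec_le (W : Weights N d) (w : List (Fin d)) (c : Option (Fin d)) :
    ‖W.nodeVec w c‖ ≤ (∑ k, ‖W.op k‖) ^ w.length * ∑ c, ‖W.src c‖ := by
  induction w with
  | nil =>
    simpa [nodeVec] using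
      Finset.single_le_sum (f := fun c => ‖W.src c‖) (fun _ _ => norm_nonneg _) (Finset.mem_univ c)
  | cons k w ih =>
    refine ((W.op k).le_opNorm _).trans ?_
    rw [List.length_cons, pow_succ', mul_assoc]
    exact mul_le_mul (Finset.single_le_sum (f := fun k => ‖W.op k‖) (fun _ _ => norm_nonneg _)
      (Finset.mem_univ k)) ih (norm_nonneg _) (Finset.sum_nonneg fun _ _ => norm_nonneg _)

/-- The summable majorant of the expansion of the randomized signature. -/
def sigBound (u : Fin d → ℝ → ℝ) (W : Weights N d) (j : Node d) : ℝ :=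
  (1 + len u) * (∑ c, ‖W.src c‖) *
    ((len u * ∑ k, ‖W.op k‖) ^ j.1.length / j.1.length.factorial)

theorem summable_sigBound (u : Fin d → ℝ → ℝ) (W : Weights N d) : Summable (sigBound u W) :=
  (summable_pow_div_factorial_node d (mul_nonneg (len_nonneg u)
    (Finset.sum_nonneg fun _ _ => norm_nonneg _))).mul_left _

theorem norm_iterInt_smul_nodeVec_le {u : Fin d → ℝ → ℝ} (hu : ∀ k, Integrable (u k))
    (W : Weights N d) (j : Node d) {t : ℝ} (ht : t ∈ Icc (0 : ℝ) 1) :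
    ‖iterInt u j.1 j.2 t • W.nodeVec j.1 j.2‖ ≤ sigBound u W j := by
  rw [norm_smul]
  have := len_nonneg u
  refine (mul_le_mul (abs_iterInt_le hu j.1 j.2 ht) (W.norm_nodeVec_le j.1 j.2) (norm_nonneg _)
    (by positivity)).trans_eq ?_
  rw [sigBound, mul_pow]
  ring

/-- The expansion of the randomized signature. -/
def sigSeries (u : Fin d → ℝ → ℝ) (W : Weights N d) (t : ℝ) : EuclideanSpace ℝ (Fin N) :=
  ∑' j : Node d, iterInt u j.1 j.2 t • W.nodeVec j.1 j.2

theorem hasSum_sigSeries {u : Fin d → ℝ → ℝ} (hu : ∀ k, Integrable (u k)) (W : Weights N d)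
    {t : ℝ} (ht : t ∈ Icc (0 : ℝ) 1) :
    HasSum (fun j : Node d => iterInt u j.1 j.2 t • W.nodeVec j.1 j.2) (sigSeries u W t) :=
  (Summable.of_norm_bounded (summable_sigBound u W)
    fun j => norm_iterInt_smul_nodeVec_le hu W j ht).hasSum

theorem continuousOn_sigSeries {u : Fin d → ℝ → ℝ} (hu : ∀ k, Integrable (u k))
    (W : Weights N d) : ContinuousOn (sigSeries u W) (Icc 0 1) :=
  continuousOn_tsum (fun j => ((continuous_iterInt hu j.1 j.2).smul continuous_const).continuousOn)
    (summable_sigBound u W) fun j _ ht => norm_iterInt_smul_nodeVec_le hu W j ht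

/-- Termwise integration by dominated convergence: prefixing the letter `k` to a node integrates its
term against `u k` and applies `A_k`. -/
theorem hasSum_integral_sigSeries {u : Fin d → ℝ → ℝ} (hu : ∀ k, Integrable (u k))
    (W : Weights N d) (k : Fin d) {t : ℝ} (ht : t ∈ Icc (0 : ℝ) 1) :
    HasSum (fun j : Node d => iterInt u (k :: j.1) j.2 t • W.nodeVec (k :: j.1) j.2)
      (∫ τ in (0 : ℝ)..t, u k τ • W.op k (sigSeries u W τ)) := by
  have hint : ∀ j : Node d, iterInt u (k :: j.1) j.2 t • W.nodeVec (k :: j.1) j.2 =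
      ∫ τ in (0 : ℝ)..t, u k τ • W.op k (iterInt u j.1 j.2 τ • W.nodeVec j.1 j.2) := by
    intro j
    simp only [map_smul, smul_smul]
    exact (intervalIntegral.integral_smul_const _ _).symm
  have hsub : ∀ τ ∈ uIoc 0 t, τ ∈ Icc (0 : ℝ) 1 := fun τ hτ => by
    rw [uIoc_of_le ht.1] at hτ
    exact ⟨hτ.1.le, hτ.2.trans ht.2⟩
  simp only [hint]
  refine intervalIntegral.hasSum_integral_of_dominated_convergence
    (fun j τ => |u k τ| * (‖W.op k‖ * sigBound u W j)) (fun j => ?_) (fun j => ?_) ?_ ?_ ?_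
  · exact (hu k).aestronglyMeasurable.restrict.smul
      ((W.op k).continuous.comp
        ((continuous_iterInt hu j.1 j.2).smul continuous_const)).aestronglyMeasurable
  · refine ae_of_all _ fun τ hτ => ?_
    rw [norm_smul]
    exact mul_le_mul_of_nonneg_left (((W.op k).le_opNorm _).trans
      (mul_le_mul_of_nonneg_left (norm_iterInt_smul_nodeVec_le hu W j (hsub τ hτ))
        (norm_nonneg _))) (norm_nonneg _)
  · exact ae_of_all _ fun τ _ => ((summable_sigBound u W).mul_left _).mul_left _
  · simp only [tsum_mul_left]
    exact (hu k).abs.intervalIntegrable.mul_const _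
  · refine ae_of_all _ fun τ hτ => ?_
    exact ((W.op k).hasSum (hasSum_sigSeries hu W (hsub τ hτ))).const_smul _

theorem intervalIntegrable_smul_op {u : ℝ → ℝ} (hu : Integrable u) (W : Weights N d) (k : Fin d)
    {S : ℝ → EuclideanSpace ℝ (Fin N)} (hS : ContinuousOn S (Icc 0 1)) {t : ℝ}
    (ht : t ∈ Icc (0 : ℝ) 1) :
    IntervalIntegrable (fun τ => u τ • W.op k (S τ)) volume 0 t := by
  refine hu.intervalIntegrable.smul_continuousOn ?_
  rw [uIcc_of_le ht.1]
  exact (W.op k).continuous.comp_continuousOn (hS.mono (Icc_subset_Icc_right ht.2))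

theorem intervalIntegrable_smul_op_add {u : ℝ → ℝ} (hu : Integrable u) (W : Weights N d)
    (k : Fin d) {S : ℝ → EuclideanSpace ℝ (Fin N)} (hS : ContinuousOn S (Icc 0 1)) {t : ℝ}
    (ht : t ∈ Icc (0 : ℝ) 1) :
    IntervalIntegrable (fun τ => u τ • (W.op k (S τ) + W.b k)) volume 0 t := by
  simp only [smul_add]
  exact (intervalIntegrable_smul_op hu W k hS ht).add
    (hu.intervalIntegrable.smul_continuousOn continuousOn_const)

/-- The empty word yields `a` and the primitives of the biases; the words that start with `k` add up
to the integral of `A_k S`. -/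
theorem sigSeries_eq {u : Fin d → ℝ → ℝ} (hu : ∀ k, Integrable (u k))
    (W : Weights N d) {t : ℝ} (ht : t ∈ Icc (0 : ℝ) 1) :
    sigSeries u W t =
      W.a + ∑ k, ∫ τ in (0 : ℝ)..t, u k τ • (W.op k (sigSeries u W τ) + W.b k) := by
  have h := hasSum_node (f := fun j : Node d => iterInt u j.1 j.2 t • W.nodeVec j.1 j.2)
    (fun k => hasSum_integral_sigSeries hu W k ht)
    ((summable_sigBound u W).of_nonneg_of_le (fun _ => norm_nonneg _)
      fun j => norm_iterInt_smul_nodeVec_le hu W j ht)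
  rw [(hasSum_sigSeries hu W ht).unique h, Fintype.sum_option, add_assoc,
    ← Finset.sum_add_distrib]
  simp only [iterInt, Weights.nodeVec, Weights.src, Option.elim, one_smul]
  congr 1
  refine Finset.sum_congr rfl fun k _ => ?_
  simp only [smul_add]
  rw [intervalIntegral.integral_add
    (intervalIntegrable_smul_op (hu k) W k (continuousOn_sigSeries hu W) ht)
    ((hu k).intervalIntegrable.smul_continuousOn continuousOn_const),
    intervalIntegral.integral_smul_const, add_comm]

theorem integral_vel_smul {E : Type*} [NormedAddCommGroup E] [NormedSpace ℝ E] (x : PathSpace d)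
    (k : Fin d) (F : ℝ → E) {t : ℝ} (ht : t ∈ Icc (0 : ℝ) 1) :
    ∫ τ in (0 : ℝ)..t, vel x k τ • F τ = ∫ τ in (0 : ℝ)..t, x.deriv τ k • F τ := by
  refine intervalIntegral.integral_congr_ae (ae_of_all _ fun τ hτ => ?_)
  rw [uIoc_of_le ht.1] at hτ
  simp only [vel_eq x k (Ioc_subset_Ioc_right ht.2 hτ)]

theorem isNeuralCDESol_iff (W : Weights N d) (x : PathSpace d)
    (S : ℝ → EuclideanSpace ℝ (Fin N)) :
    IsNeuralCDESol id W x S ↔ ContinuousOn S (Icc 0 1) ∧ ∀ t ∈ Icc (0 : ℝ) 1,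
      S t = W.a + ∑ k, ∫ τ in (0 : ℝ)..t, vel x k τ • (W.op k (S τ) + W.b k) := by
  refine and_congr_right fun _ => forall₂_congr fun t ht => ?_
  simp only [integral_vel_smul x _ _ ht, Weights.op_apply]

theorem isNeuralCDESol_sigSeries (W : Weights N d) (x : PathSpace d) :
    IsNeuralCDESol id W x (sigSeries (vel x) W) :=
  (isNeuralCDESol_iff W x _).2 ⟨continuousOn_sigSeries (integrable_vel x) W,
    fun _ ht => sigSeries_eq (integrable_vel x) W ht⟩

/-- The difference of two solutions solves the homogeneous linear equation, so Grönwall applies with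
weight `speed · ∑ ‖A_k‖`. -/
theorem IsNeuralCDESol.eqOn {W : Weights N d} {x : PathSpace d}
    {S T : ℝ → EuclideanSpace ℝ (Fin N)} (hS : IsNeuralCDESol id W x S)
    (hT : IsNeuralCDESol id W x T) : EqOn S T (Icc 0 1) := by
  rw [isNeuralCDESol_iff] at hS hT
  obtain ⟨hSc, hS⟩ := hS
  obtain ⟨hTc, hT⟩ := hT
  obtain ⟨M, hM⟩ := isCompact_Icc.exists_bound_of_continuousOn (hSc.sub hTc)
  have hu := integrable_vel x
  have h := eq_zero_of_norm_le_integral (D := fun t => S t - T t)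
    (F := fun _ τ => ∑ k, vel x k τ • W.op k (S τ - T τ))
    ((integrable_speed hu).mul_const (∑ k, ‖W.op k‖)) hM ?_ ?_ ?_
  · exact fun t ht => sub_eq_zero.1 (h t ht)
  · intro t ht
    rw [intervalIntegral.integral_finsetSum, hS t ht, hT t ht, add_sub_add_left_eq_sub,
      ← Finset.sum_sub_distrib]
    · refine Finset.sum_congr rfl fun k _ => ?_
      rw [← intervalIntegral.integral_sub (intervalIntegrable_smul_op_add (hu k) W k hSc ht)
        (intervalIntegrable_smul_op_add (hu k) W k hTc ht)]
      congr 1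
      ext1 τ
      rw [map_sub, ← smul_sub, add_sub_add_right_eq_sub]
    · exact fun k _ => intervalIntegrable_smul_op (hu k) W k (hSc.sub hTc) ht
  · intro t _ τ _
    rw [mul_assoc, Finset.sum_mul, Finset.mul_sum]
    refine norm_sum_le_of_le _ fun k _ => ?_
    rw [norm_smul]
    exact mul_le_mul (abs_le_speed _ k τ) ((W.op k).le_opNorm _) (norm_nonneg _)
      (speed_nonneg _ τ)
  · exact fun τ => mul_nonneg (speed_nonneg _ τ) (Finset.sum_nonneg fun _ _ => norm_nonneg _)

theorem isNeuralCDESol_randSig (W : Weights N d) (x : PathSpace d) :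
    IsNeuralCDESol id W x (randSig id W x) :=
  Classical.epsilon_spec ⟨_, isNeuralCDESol_sigSeries W x⟩

theorem hasSum_randSig (W : Weights N d) (x : PathSpace d) {t : ℝ} (ht : t ∈ Icc (0 : ℝ) 1) :
    HasSum (fun j : Node d => iterInt (vel x) j.1 j.2 t • W.nodeVec j.1 j.2)
      (randSig id W x t) := by
  rw [(isNeuralCDESol_randSig W x).eqOn (isNeuralCDESol_sigSeries W x) ht]
  exact hasSum_sigSeries (integrable_vel x) W ht

end CDE

/-! ### The linear kernel equation: expansion and uniqueness -/

section Kernel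
variable {d : ℕ} {σa σA σb : ℝ}

/-- For a centred Gaussian pair, `V` is the covariance of the coordinates. Positive semidefiniteness
is what makes `Sig` the actual covariance matrix of the law. -/
theorem V_id {Sig : Matrix (Fin 2) (Fin 2) ℝ} (h : Sig.PosSemidef) : V id Sig = Sig 0 1 := by
  rw [← covariance_eval_multivariateGaussian (μ := 0) h 0 1]
  have hm : ∀ i : Fin 2,
      ∫ z, z i ∂(multivariateGaussian (0 : EuclideanSpace ℝ (Fin 2)) Sig) = 0 := fun i => by
    have := (EuclideanSpace.proj (𝕜 := ℝ) i).integral_comp_id_comm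
      (μ := multivariateGaussian (0 : EuclideanSpace ℝ (Fin 2)) Sig) IsGaussian.integrable_id
    simpa using this
  simp [covariance, hm, V]

/-- The variance of a source. -/
def srcVar (σa σb : ℝ) (c : Option (Fin d)) : ℝ :=
  c.elim (σa ^ 2) fun _ => σb ^ 2

theorem srcVar_nonneg (c : Option (Fin d)) : 0 ≤ srcVar σa σb c := by
  cases c <;> exact sq_nonneg _

theorem srcVar_le (c : Option (Fin d)) : srcVar σa σb c ≤ σa ^ 2 + σb ^ 2 := by
  cases c
  · exact le_add_of_nonneg_right (sq_nonneg _)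
  · exact le_add_of_nonneg_left (sq_nonneg _)

/-- The limit of the mean square norm of the vector of a node. -/
def nodeVar (σa σA σb : ℝ) (j : Node d) : ℝ :=
  (σA ^ 2) ^ j.1.length * srcVar σa σb j.2

theorem nodeVar_nonneg (j : Node d) : 0 ≤ nodeVar σa σA σb j :=
  mul_nonneg (by positivity) (srcVar_nonneg _)

theorem nodeVar_cons (k : Fin d) (j : Node d) :
    nodeVar σa σA σb (k :: j.1, j.2) = σA ^ 2 * nodeVar σa σA σb j := by
  simp only [nodeVar, List.length_cons, pow_succ]
  ring

/-- The expansion of the identity neural signature kernel. -/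
def kerSeries (σa σA σb : ℝ) (u v : Fin d → ℝ → ℝ) (s t : ℝ) : ℝ :=
  ∑' j : Node d, nodeVar σa σA σb j * (iterInt u j.1 j.2 s * iterInt v j.1 j.2 t)

/-- The summable majorant of the expansion of the kernel. -/
def kerBound (σa σA σb : ℝ) (u v : Fin d → ℝ → ℝ) (j : Node d) : ℝ :=
  (σa ^ 2 + σb ^ 2) * ((1 + len u) * (1 + len v)) *
    ((σA ^ 2 * (len u * len v)) ^ j.1.length / j.1.length.factorial)

theorem summable_kerBound (u v : Fin d → ℝ → ℝ) : Summable (kerBound σa σA σb u v) :=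
  (summable_pow_div_factorial_node d (mul_nonneg (sq_nonneg _)
    (mul_nonneg (len_nonneg u) (len_nonneg v)))).mul_left _

variable {u v : Fin d → ℝ → ℝ}

/-- One of the two factorials already gives a summable majorant; the other is bounded below by `1`.
-/
theorem abs_kerSeries_term_le (hu : ∀ k, Integrable (u k)) (hv : ∀ k, Integrable (v k))
    (j : Node d) {s t : ℝ} (hs : s ∈ Icc (0 : ℝ) 1) (ht : t ∈ Icc (0 : ℝ) 1) :
    |nodeVar σa σA σb j * (iterInt u j.1 j.2 s * iterInt v j.1 j.2 t)| ≤
      kerBound σa σA σb u v j := by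
  have hlu := len_nonneg u
  have hlv := len_nonneg v
  have hv0 := srcVar_nonneg (σa := σa) (σb := σb) j.2
  rw [abs_mul, abs_mul, abs_of_nonneg (nodeVar_nonneg j)]
  have h1 : |iterInt v j.1 j.2 t| ≤ (1 + len v) * len v ^ j.1.length := by
    refine (abs_iterInt_le hv j.1 j.2 ht).trans (mul_le_mul_of_nonneg_left ?_ (by positivity))
    exact div_le_self (by positivity) (mod_cast Nat.one_le_iff_ne_zero.2 (Nat.factorial_ne_zero _))
  refine (mul_le_mul_of_nonneg_left (mul_le_mul (abs_iterInt_le hu j.1 j.2 hs) h1 (abs_nonneg _)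
    (by positivity)) (nodeVar_nonneg j)).trans ?_
  rw [nodeVar, kerBound, mul_pow, mul_pow]
  calc _ = srcVar σa σb j.2 * ((1 + len u) * (1 + len v) * ((σA ^ 2) ^ j.1.length *
        (len u ^ j.1.length * len v ^ j.1.length) / j.1.length.factorial)) := by ring
    _ ≤ (σa ^ 2 + σb ^ 2) * ((1 + len u) * (1 + len v) * ((σA ^ 2) ^ j.1.length *
        (len u ^ j.1.length * len v ^ j.1.length) / j.1.length.factorial)) :=
      mul_le_mul_of_nonneg_right (srcVar_le _) (by positivity)
    _ = _ := by ring

theorem hasSum_kerSeries (hu : ∀ k, Integrable (u k)) (hv : ∀ k, Integrable (v k))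
    {s t : ℝ} (hs : s ∈ Icc (0 : ℝ) 1) (ht : t ∈ Icc (0 : ℝ) 1) :
    HasSum (fun j : Node d => nodeVar σa σA σb j * (iterInt u j.1 j.2 s * iterInt v j.1 j.2 t))
      (kerSeries σa σA σb u v s t) :=
  (Summable.of_norm_bounded (summable_kerBound u v)
    fun j => abs_kerSeries_term_le hu hv j hs ht).hasSum

theorem continuousOn_kerSeries (hu : ∀ k, Integrable (u k)) (hv : ∀ k, Integrable (v k)) :
    ContinuousOn (fun p : ℝ × ℝ => kerSeries σa σA σb u v p.1 p.2) (Icc 0 1 ×ˢ Icc 0 1) :=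
  continuousOn_tsum (fun j => (continuous_const.mul
      (((continuous_iterInt hu j.1 j.2).comp continuous_fst).mul
        ((continuous_iterInt hv j.1 j.2).comp continuous_snd))).continuousOn)
    (summable_kerBound u v) fun j _ hp => abs_kerSeries_term_le hu hv j hp.1 hp.2

/-- Dominated convergence twice, in `τ` for fixed `η` and then in `η`. -/
theorem hasSum_integral_kerSeries (hu : ∀ k, Integrable (u k)) (hv : ∀ k, Integrable (v k))
    (k : Fin d) {s t : ℝ} (hs : s ∈ Icc (0 : ℝ) 1) (ht : t ∈ Icc (0 : ℝ) 1) :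
    HasSum (fun j : Node d => nodeVar σa σA σb (k :: j.1, j.2) *
        (iterInt u (k :: j.1) j.2 s * iterInt v (k :: j.1) j.2 t))
      (∫ η in (0 : ℝ)..s, u k η *
        ∫ τ in (0 : ℝ)..t, v k τ * (σA ^ 2 * kerSeries σa σA σb u v η τ)) := by
  have hsub : ∀ {r : ℝ}, r ∈ Icc (0 : ℝ) 1 → ∀ τ ∈ uIoc 0 r, τ ∈ Icc (0 : ℝ) 1 :=
    fun hr τ hτ => by
      rw [uIoc_of_le hr.1] at hτ
      exact ⟨hτ.1.le, hτ.2.trans hr.2⟩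
  have hint' : ∀ (j : Node d) (η : ℝ), σA ^ 2 * nodeVar σa σA σb j * iterInt u j.1 j.2 η *
      iterInt v (k :: j.1) j.2 t = ∫ τ in (0 : ℝ)..t, v k τ * (σA ^ 2 *
        (nodeVar σa σA σb j * (iterInt u j.1 j.2 η * iterInt v j.1 j.2 τ))) := fun j η => by
    rw [iterInt, ← intervalIntegral.integral_const_mul]
    congr 1
    ext1 τ
    ring
  have hterm : ∀ (j : Node d), ∀ η ∈ Icc (0 : ℝ) 1, ∀ τ ∈ uIoc 0 t,
      ‖v k τ * (σA ^ 2 * (nodeVar σa σA σb j * (iterInt u j.1 j.2 η * iterInt v j.1 j.2 τ)))‖ ≤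
        |v k τ| * (σA ^ 2 * kerBound σa σA σb u v j) := fun j η hη τ hτ => by
    rw [norm_mul, norm_mul, Real.norm_of_nonneg (sq_nonneg σA)]
    exact mul_le_mul_of_nonneg_left (mul_le_mul_of_nonneg_left
      (abs_kerSeries_term_le hu hv j hη (hsub ht τ hτ)) (sq_nonneg _)) (norm_nonneg _)
  have hinner : ∀ η ∈ Icc (0 : ℝ) 1,
      HasSum (fun j : Node d => σA ^ 2 * nodeVar σa σA σb j * iterInt u j.1 j.2 η *
          iterInt v (k :: j.1) j.2 t)
        (∫ τ in (0 : ℝ)..t, v k τ * (σA ^ 2 * kerSeries σa σA σb u v η τ)) := by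
    intro η hη
    simp only [hint' _ η]
    refine intervalIntegral.hasSum_integral_of_dominated_convergence
      (fun j τ => |v k τ| * (σA ^ 2 * kerBound σa σA σb u v j))
      (fun j => ?_) (fun j => ?_) ?_ ?_ ?_
    · exact (hv k).aestronglyMeasurable.restrict.mul (continuous_const.mul (continuous_const.mul
        (continuous_const.mul (continuous_iterInt hv j.1 j.2)))).aestronglyMeasurable
    · exact ae_of_all _ fun τ hτ => hterm j η hη τ hτ
    · exact ae_of_all _ fun τ _ => ((summable_kerBound u v).mul_left _).mul_left _
    · simp only [tsum_mul_left]
      exact (hv k).abs.intervalIntegrable.mul_const _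
    · exact ae_of_all _ fun τ hτ =>
        ((hasSum_kerSeries hu hv hη (hsub ht τ hτ)).mul_left _).mul_left _
  have hint : ∀ j : Node d, nodeVar σa σA σb (k :: j.1, j.2) *
      (iterInt u (k :: j.1) j.2 s * iterInt v (k :: j.1) j.2 t) = ∫ η in (0 : ℝ)..s, u k η *
        (σA ^ 2 * nodeVar σa σA σb j * iterInt u j.1 j.2 η * iterInt v (k :: j.1) j.2 t) := by
    intro j
    rw [nodeVar_cons, iterInt, ← intervalIntegral.integral_mul_const,
      ← intervalIntegral.integral_const_mul]
    congr 1
    ext1 η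
    ring
  obtain ⟨M, hM⟩ : ∃ M, ∀ j : Node d, ∀ η ∈ Icc (0 : ℝ) 1,
      ‖σA ^ 2 * nodeVar σa σA σb j * iterInt u j.1 j.2 η * iterInt v (k :: j.1) j.2 t‖ ≤
        M * kerBound σa σA σb u v j := by
    -- A bound of the inner integrals that is uniform in `η`, as needed to dominate the outer one.
    refine ⟨σA ^ 2 * ∫ τ in (0 : ℝ)..t, |v k τ|, fun j η hη => ?_⟩
    rw [hint']
    refine (intervalIntegral.norm_integral_le_of_norm_le ht.1
      (ae_of_all _ fun τ hτ => hterm j η hη τ (uIoc_of_le ht.1 ▸ hτ))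
      ((hv k).abs.intervalIntegrable.mul_const _)).trans_eq ?_
    rw [intervalIntegral.integral_mul_const]
    ring
  simp only [hint]
  refine intervalIntegral.hasSum_integral_of_dominated_convergence
    (fun j τ => |u k τ| * (M * kerBound σa σA σb u v j))
    (fun j => ?_) (fun j => ?_) ?_ ?_ ?_
  · exact (hu k).aestronglyMeasurable.restrict.mul ((continuous_const.mul
      (continuous_iterInt hu j.1 j.2)).mul continuous_const).aestronglyMeasurable
  · refine ae_of_all _ fun η hη => ?_
    rw [norm_mul]
    exact mul_le_mul_of_nonneg_left (hM j η (hsub hs η hη)) (norm_nonneg _)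
  · exact ae_of_all _ fun τ _ => ((summable_kerBound u v).mul_left _).mul_left _
  · simp only [tsum_mul_left]
    exact (hu k).abs.intervalIntegrable.mul_const _
  · exact ae_of_all _ fun η hη => (hinner η (hsub hs η hη)).mul_left _

theorem kerSeries_eq (hu : ∀ k, Integrable (u k)) (hv : ∀ k, Integrable (v k))
    {s t : ℝ} (hs : s ∈ Icc (0 : ℝ) 1) (ht : t ∈ Icc (0 : ℝ) 1) :
    kerSeries σa σA σb u v s t = σa ^ 2 +
      ∑ k, ((σb ^ 2 * ((∫ η in (0 : ℝ)..s, u k η) * ∫ τ in (0 : ℝ)..t, v k τ)) +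
      ∫ η in (0 : ℝ)..s, u k η *
        ∫ τ in (0 : ℝ)..t, v k τ * (σA ^ 2 * kerSeries σa σA σb u v η τ)) := by
  have h := hasSum_node (f := fun j : Node d =>
      nodeVar σa σA σb j * (iterInt u j.1 j.2 s * iterInt v j.1 j.2 t))
    (fun k => hasSum_integral_kerSeries hu hv k hs ht)
    ((summable_kerBound u v).of_nonneg_of_le (fun _ => norm_nonneg _)
      fun j => abs_kerSeries_term_le hu hv j hs ht)
  rw [(hasSum_kerSeries hu hv hs ht).unique h, Fintype.sum_option, add_assoc,
    ← Finset.sum_add_distrib]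
  simp [iterInt, nodeVar, srcVar]

theorem continuousOn_integral_mul {Φ : ℝ × ℝ → ℝ} (hΦ : ContinuousOn Φ (Icc 0 1 ×ˢ Icc 0 1))
    {v : ℝ → ℝ} (hv : Integrable v) {t : ℝ} (ht : t ∈ Icc (0 : ℝ) 1) :
    ContinuousOn (fun η => ∫ τ in (0 : ℝ)..t, v τ * Φ (η, τ)) (Icc 0 1) := by
  obtain ⟨M, hM⟩ := (isCompact_Icc.prod isCompact_Icc).exists_bound_of_continuousOn hΦ
  -- Clamping both variables to `[0,1]` replaces `Φ` by a globally continuous and bounded function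
  -- that agrees with it on the square.
  set p : ℝ → ℝ := fun r => (projIcc (0 : ℝ) 1 zero_le_one r : ℝ) with hp
  have hpc : Continuous p := continuous_subtype_val.comp continuous_projIcc
  have hpm : ∀ r, p r ∈ Icc (0 : ℝ) 1 := fun r => (projIcc (0 : ℝ) 1 zero_le_one r).2
  have hpe : ∀ r ∈ Icc (0 : ℝ) 1, p r = r := fun r hr => by simp [hp, projIcc_of_mem _ hr]
  have hc : Continuous fun q : ℝ × ℝ => Φ (p q.1, p q.2) :=
    hΦ.comp_continuous ((hpc.comp continuous_fst).prodMk (hpc.comp continuous_snd))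
      fun q => ⟨hpm _, hpm _⟩
  have : Continuous fun η => ∫ τ in (0 : ℝ)..t, v τ * Φ (p η, p τ) := by
    refine intervalIntegral.continuous_of_dominated_interval (bound := fun τ => |v τ| * M)
      (fun η => ?_) (fun η => ?_) (hv.abs.intervalIntegrable.mul_const _) ?_
    · exact hv.aestronglyMeasurable.restrict.mul
        (hc.comp (continuous_const.prodMk continuous_id)).aestronglyMeasurable
    · refine ae_of_all _ fun τ _ => ?_
      rw [norm_mul]
      exact mul_le_mul_of_nonneg_left (hM _ ⟨hpm _, hpm _⟩) (norm_nonneg _)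
    · exact ae_of_all _ fun τ _ => continuous_const.mul
        (hc.comp (continuous_id.prodMk continuous_const))
  refine this.continuousOn.congr fun η hη => intervalIntegral.integral_congr fun τ hτ => ?_
  rw [uIcc_of_le ht.1] at hτ
  simp only [hpe η hη, hpe τ ⟨hτ.1, hτ.2.trans ht.2⟩]

theorem intervalIntegrable_mul_section {Φ : ℝ × ℝ → ℝ}
    (hΦ : ContinuousOn Φ (Icc 0 1 ×ˢ Icc 0 1)) {v : ℝ → ℝ} (hv : Integrable v) {η t : ℝ}
    (hη : η ∈ Icc (0 : ℝ) 1) (ht : t ∈ Icc (0 : ℝ) 1) :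
    IntervalIntegrable (fun τ => v τ * Φ (η, τ)) volume 0 t := by
  refine hv.intervalIntegrable.mul_continuousOn ?_
  rw [uIcc_of_le ht.1]
  exact hΦ.comp (continuousOn_const.prodMk continuousOn_id)
    fun τ hτ => ⟨hη, hτ.1, hτ.2.trans ht.2⟩

theorem intervalIntegrable_mul_integral {Φ : ℝ × ℝ → ℝ}
    (hΦ : ContinuousOn Φ (Icc 0 1 ×ˢ Icc 0 1)) {u v : ℝ → ℝ} (hu : Integrable u)
    (hv : Integrable v) {s t : ℝ} (hs : s ∈ Icc (0 : ℝ) 1) (ht : t ∈ Icc (0 : ℝ) 1) :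
    IntervalIntegrable (fun η => u η * ∫ τ in (0 : ℝ)..t, v τ * Φ (η, τ)) volume 0 s := by
  refine hu.intervalIntegrable.mul_continuousOn ?_
  rw [uIcc_of_le hs.1]
  exact (continuousOn_integral_mul hΦ hv ht).mono (Icc_subset_Icc_right hs.2)

/-- The double integral against `⟨ẋ, ẏ⟩` in coordinates. -/
theorem integral_integral_mul_inner_deriv (x y : PathSpace d) {Φ : ℝ × ℝ → ℝ}
    (hΦ : ContinuousOn Φ (Icc 0 1 ×ˢ Icc 0 1)) {s t : ℝ} (hs : s ∈ Icc (0 : ℝ) 1)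
    (ht : t ∈ Icc (0 : ℝ) 1) :
    ∫ η in (0 : ℝ)..s, ∫ τ in (0 : ℝ)..t, Φ (η, τ) * inner ℝ (x.deriv η) (y.deriv τ) =
      ∑ k, ∫ η in (0 : ℝ)..s, vel x k η * ∫ τ in (0 : ℝ)..t, vel y k τ * Φ (η, τ) := by
  rw [← intervalIntegral.integral_finsetSum fun k _ =>
    intervalIntegrable_mul_integral hΦ (integrable_vel x k) (integrable_vel y k) hs ht]
  refine intervalIntegral.integral_congr_ae (ae_of_all _ fun η hη => ?_)
  rw [uIoc_of_le hs.1] at hη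
  have hη' : η ∈ Ioc (0 : ℝ) 1 := Ioc_subset_Ioc_right hs.2 hη
  simp only [← intervalIntegral.integral_const_mul]
  rw [← intervalIntegral.integral_finsetSum fun k _ => (intervalIntegrable_mul_section hΦ
    (integrable_vel y k) (Ioc_subset_Icc_self hη') ht).const_mul _]
  refine intervalIntegral.integral_congr_ae (ae_of_all _ fun τ hτ => ?_)
  rw [uIoc_of_le ht.1] at hτ
  have hτ' : τ ∈ Ioc (0 : ℝ) 1 := Ioc_subset_Ioc_right ht.2 hτ
  rw [PiLp.inner_apply, Finset.mul_sum]
  refine Finset.sum_congr rfl fun k _ => ?_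
  rw [vel_eq x k hη', vel_eq y k hτ']
  simp only [RCLike.inner_apply, conj_trivial]
  ring

/-- The quadratic form of the matrix is a series of squares with the nonnegative weights `nodeVar`.
-/
theorem kerSeries_posSemidef (x y : PathSpace d) {s t : ℝ} (hs : s ∈ Icc (0 : ℝ) 1)
    (ht : t ∈ Icc (0 : ℝ) 1) :
    (covMat (fun x y : PathSpace d => kerSeries σa σA σb (vel x) (vel y)) x y s t).PosSemidef := by
  refine Matrix.PosSemidef.of_dotProduct_mulVec_nonneg ?_ fun z => ?_
  · ext i j
    fin_cases i <;> fin_cases j <;> simp [covMat]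
  · have hx := integrable_vel x
    have hy := integrable_vel y
    have h1 := hasSum_kerSeries (σa := σa) (σA := σA) (σb := σb) hx hx hs hs
    have h2 := hasSum_kerSeries (σa := σa) (σA := σA) (σb := σb) hx hy hs ht
    have h3 := hasSum_kerSeries (σa := σa) (σA := σA) (σb := σb) hy hy ht ht
    have h := ((h1.mul_left (z 0 ^ 2)).add (h2.mul_left (2 * z 0 * z 1))).add
      (h3.mul_left (z 1 ^ 2))
    have h0 := h.nonneg fun j => by
      have : 0 ≤ nodeVar σa σA σb j * (z 0 * iterInt (vel x) j.1 j.2 s +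
          z 1 * iterInt (vel y) j.1 j.2 t) ^ 2 := mul_nonneg (nodeVar_nonneg j) (sq_nonneg _)
      linarith
    simp only [covMat, Matrix.mulVec, dotProduct, Fin.sum_univ_two, star_trivial,
      Matrix.of_apply, Matrix.cons_val_zero, Matrix.cons_val_one, Matrix.cons_val',
      Matrix.cons_val_fin_one, Pi.star_apply]
    linarith

theorem integral_V_covMat {K : PathSpace d → PathSpace d → ℝ → ℝ → ℝ} {x y : PathSpace d}
    (hK : ∀ s ∈ Icc (0 : ℝ) 1, ∀ t ∈ Icc (0 : ℝ) 1, (covMat K x y s t).PosSemidef) {s t : ℝ}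
    (hs : s ∈ Icc (0 : ℝ) 1) (ht : t ∈ Icc (0 : ℝ) 1) :
    ∫ η in (0 : ℝ)..s, ∫ τ in (0 : ℝ)..t,
        (σA ^ 2 * V id (covMat K x y η τ) + σb ^ 2) * inner ℝ (x.deriv η) (y.deriv τ) =
      ∫ η in (0 : ℝ)..s, ∫ τ in (0 : ℝ)..t,
        (σA ^ 2 * K x y η τ + σb ^ 2) * inner ℝ (x.deriv η) (y.deriv τ) := by
  refine intervalIntegral.integral_congr fun η hη => ?_
  rw [uIcc_of_le hs.1] at hη
  refine intervalIntegral.integral_congr fun τ hτ => ?_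
  rw [uIcc_of_le ht.1] at hτ
  rw [V_id (hK η ⟨hη.1, hη.2.trans hs.2⟩ τ ⟨hτ.1, hτ.2.trans ht.2⟩)]
  rfl

theorem isNeuralSigKernel_kerSeries :
    IsNeuralSigKernel (d := d) id σa σA σb
      fun x y => kerSeries σa σA σb (vel x) (vel y) where
  continuousOn x y := continuousOn_kerSeries (integrable_vel x) (integrable_vel y)
  posSemidef x y s hs t ht := kerSeries_posSemidef x y hs ht
  eq x y s hs t ht := by
    have hx := integrable_vel x
    have hy := integrable_vel y
    have hc := (continuousOn_kerSeries (σa := σa) (σA := σA) (σb := σb) hx hy).const_mul (σA ^ 2)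
    rw [integral_V_covMat (fun s hs t ht => kerSeries_posSemidef x y hs ht) hs ht,
      integral_integral_mul_inner_deriv x y
        (Φ := fun p => σA ^ 2 * kerSeries σa σA σb (vel x) (vel y) p.1 p.2 + σb ^ 2)
        (hc.add continuousOn_const) hs ht, kerSeries_eq hx hy hs ht]
    congr 1
    refine Finset.sum_congr rfl fun k _ => ?_
    rw [← intervalIntegral.integral_mul_const, ← intervalIntegral.integral_const_mul,
      ← intervalIntegral.integral_add]
    · refine intervalIntegral.integral_congr fun η hη => ?_
      rw [uIcc_of_le hs.1] at hη
      have hη' : η ∈ Icc (0 : ℝ) 1 := ⟨hη.1, hη.2.trans hs.2⟩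
      simp only [mul_add]
      rw [intervalIntegral.integral_add (intervalIntegrable_mul_section hc (hy k) hη' ht)
        ((hy k).intervalIntegrable.mul_const _), intervalIntegral.integral_mul_const]
      ring
    · exact ((hx k).intervalIntegrable.mul_const _).const_mul _
    · exact intervalIntegrable_mul_integral hc (hx k) (hy k) hs ht

/-- After linearisation by `V_id` the terms in `σa` and `σb` cancel in the difference of two
solutions, and the two-variable Grönwall lemma applies with weights `σA² speed` and `speed`. -/
theorem IsNeuralSigKernel.eq_of_id {K K' : PathSpace d → PathSpace d → ℝ → ℝ → ℝ}
    (hK : IsNeuralSigKernel id σa σA σb K) (hK' : IsNeuralSigKernel id σa σA σb K')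
    (x y : PathSpace d) {s t : ℝ} (hs : s ∈ Icc (0 : ℝ) 1) (ht : t ∈ Icc (0 : ℝ) 1) :
    K x y s t = K' x y s t := by
  have hx := integrable_vel x
  have hy := integrable_vel y
  have hc : ContinuousOn (fun p : ℝ × ℝ => σA ^ 2 * K x y p.1 p.2 + σb ^ 2)
      (Icc 0 1 ×ˢ Icc 0 1) :=
    ((hK.continuousOn x y).const_mul _).add continuousOn_const
  have hc' : ContinuousOn (fun p : ℝ × ℝ => σA ^ 2 * K' x y p.1 p.2 + σb ^ 2)
      (Icc 0 1 ×ˢ Icc 0 1) :=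
    ((hK'.continuousOn x y).const_mul _).add continuousOn_const
  obtain ⟨M, hM⟩ := (isCompact_Icc.prod isCompact_Icc).exists_bound_of_continuousOn
    ((hK.continuousOn x y).sub (hK'.continuousOn x y))
  have h := eq_zero_of_norm_le_integral_integral
    (D := fun s t => K x y s t - K' x y s t)
    (F := fun η τ => σA ^ 2 * (∑ k, vel x k η * vel y k τ) * (K x y η τ - K' x y η τ))
    ((integrable_speed hx).const_mul (σA ^ 2)) (integrable_speed hy)
    (fun s hs t ht => hM (s, t) ⟨hs, ht⟩) ?_ ?_ ?_ (speed_nonneg _)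
  · exact sub_eq_zero.1 (h s hs t ht)
  · intro s hs t ht
    rw [hK.eq x y s hs t ht, hK'.eq x y s hs t ht, add_sub_add_left_eq_sub,
      integral_V_covMat (hK.posSemidef x y) hs ht, integral_V_covMat (hK'.posSemidef x y) hs ht,
      integral_integral_mul_inner_deriv x y hc hs ht,
      integral_integral_mul_inner_deriv x y hc' hs ht, ← Finset.sum_sub_distrib]
    have hk : ∀ k, (∫ η in (0 : ℝ)..s, vel x k η * ∫ τ in (0 : ℝ)..t,
          vel y k τ * (σA ^ 2 * K x y η τ + σb ^ 2)) -
        (∫ η in (0 : ℝ)..s, vel x k η * ∫ τ in (0 : ℝ)..t,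
          vel y k τ * (σA ^ 2 * K' x y η τ + σb ^ 2)) =
        ∫ η in (0 : ℝ)..s, vel x k η * ∫ τ in (0 : ℝ)..t,
          vel y k τ * ((σA ^ 2 * K x y η τ + σb ^ 2) - (σA ^ 2 * K' x y η τ + σb ^ 2)) := by
      intro k
      rw [← intervalIntegral.integral_sub
        (intervalIntegrable_mul_integral hc (hx k) (hy k) hs ht)
        (intervalIntegrable_mul_integral hc' (hx k) (hy k) hs ht)]
      refine intervalIntegral.integral_congr fun η hη => ?_
      rw [uIcc_of_le hs.1] at hη
      have hη' : η ∈ Icc (0 : ℝ) 1 := ⟨hη.1, hη.2.trans hs.2⟩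
      simp only [← mul_sub]
      rw [← intervalIntegral.integral_sub (intervalIntegrable_mul_section hc (hy k) hη' ht)
        (intervalIntegrable_mul_section hc' (hy k) hη' ht)]
      simp only [← mul_sub]
    have hcc : ContinuousOn (fun p : ℝ × ℝ => (σA ^ 2 * K x y p.1 p.2 + σb ^ 2) -
        (σA ^ 2 * K' x y p.1 p.2 + σb ^ 2)) (Icc 0 1 ×ˢ Icc 0 1) := hc.sub hc'
    simp only [hk]
    rw [← intervalIntegral.integral_finsetSum fun k _ =>
      intervalIntegrable_mul_integral hcc (hx k) (hy k) hs ht]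
    refine intervalIntegral.integral_congr fun η hη => ?_
    rw [uIcc_of_le hs.1] at hη
    have hη' : η ∈ Icc (0 : ℝ) 1 := ⟨hη.1, hη.2.trans hs.2⟩
    simp only [← intervalIntegral.integral_const_mul]
    rw [← intervalIntegral.integral_finsetSum fun k _ =>
      (intervalIntegrable_mul_section hcc (hy k) hη' ht).const_mul _]
    refine intervalIntegral.integral_congr fun τ _ => ?_
    simp only [Finset.mul_sum, Finset.sum_mul]
    refine Finset.sum_congr rfl fun k _ => ?_
    ring
  · intro η _ τ _
    rw [norm_mul, norm_mul, Real.norm_of_nonneg (sq_nonneg σA), mul_assoc (σA ^ 2) (speed _ _)]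
    refine mul_le_mul_of_nonneg_right (mul_le_mul_of_nonneg_left ?_ (sq_nonneg _)) (norm_nonneg _)
    rw [speed, Finset.sum_mul]
    refine norm_sum_le_of_le _ fun k _ => ?_
    rw [norm_mul]
    exact mul_le_mul_of_nonneg_left (abs_le_speed _ k τ) (norm_nonneg _)
  · exact fun η => mul_nonneg (sq_nonneg _) (speed_nonneg _ η)

theorem isNeuralSigKernel_neuralSigKernel :
    IsNeuralSigKernel (d := d) id σa σA σb (neuralSigKernel id σa σA σb) :=
  Classical.epsilon_spec ⟨_, isNeuralSigKernel_kerSeries⟩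

theorem hasSum_neuralSigKernel (x y : PathSpace d) {s t : ℝ} (hs : s ∈ Icc (0 : ℝ) 1)
    (ht : t ∈ Icc (0 : ℝ) 1) :
    HasSum (fun j : Node d => nodeVar σa σA σb j *
        (iterInt (vel x) j.1 j.2 s * iterInt (vel y) j.1 j.2 t))
      (neuralSigKernel id σa σA σb x y s t) := by
  rw [isNeuralSigKernel_neuralSigKernel.eq_of_id isNeuralSigKernel_kerSeries x y hs ht]
  exact hasSum_kerSeries (integrable_vel x) (integrable_vel y) hs ht

end Kernel

/-! ### Words in Gaussian matrices and Stein's identity -/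

/-- The index type of the scalar entries of the weights. -/
abbrev Entry (N d : ℕ) : Type := Fin N ⊕ (Fin d × Fin N × Fin N) ⊕ (Fin d × Fin N)

/-- Polynomials in the entries of the weights. -/
abbrev Poly (N d : ℕ) : Type := MvPolynomial (Entry N d) ℝ

/-- A linear functional on polynomials that satisfies Stein's identity for independent centered
Gaussian variables with the given variances. -/
structure IsWick {N d : ℕ} (E : Poly N d →ₗ[ℝ] ℝ) (var : Entry N d → ℝ) : Prop where
  map_one : E 1 = 1
  stein : ∀ e p, E (MvPolynomial.X e * p) = var e * E (MvPolynomial.pderiv e p)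

/-- All the ways to cut a list at one of its members. -/
def splits {α : Type*} : List α → List (List α × α × List α)
  | [] => []
  | a :: l => ([], a, l) :: (splits l).map fun s => (a :: s.1, s.2)

theorem length_splits {α : Type*} (l : List α) : (splits l).length = l.length := by
  induction l with
  | nil => rfl
  | cons a l ih => simp [splits, ih]

theorem length_of_mem_splits {α : Type*} {l : List α} {s : List α × α × List α}
    (h : s ∈ splits l) : s.1.length + s.2.2.length + 1 = l.length := by
  induction l generalizing s with
  | nil => simp [splits] at h
  | cons a l ih =>
    simp only [splits, List.mem_cons, List.mem_map] at h
    obtain rfl | ⟨s, hs, rfl⟩ := h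
    · simp
    · simpa [Nat.add_right_comm] using ih hs

theorem eq_of_mem_splits {α : Type*} {l : List α} {s : List α × α × List α}
    (h : s ∈ splits l) : l = s.1 ++ s.2.1 :: s.2.2 := by
  induction l generalizing s with
  | nil => simp [splits] at h
  | cons a l ih =>
    simp only [splits, List.mem_cons, List.mem_map] at h
    obtain rfl | ⟨s, hs, rfl⟩ := h
    · simp
    · simpa using ih hs

theorem splits_append {α : Type*} (l m : List α) :
    splits (l ++ m) = (splits l).map (fun s => (s.1, s.2.1, s.2.2 ++ m)) ++
      (splits m).map fun s => (l ++ s.1, s.2) := by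
  induction l with
  | nil => simp [splits]
  | cons a l ih => simp [splits, ih, Function.comp_def]

theorem sum_sum_map {α ι R : Type*} [AddCommMonoid R] (s : Finset ι) (l : List α)
    (f : ι → α → R) : ∑ i ∈ s, (l.map (f i)).sum = (l.map fun a => ∑ i ∈ s, f i a).sum := by
  induction l with
  | nil => simp
  | cons a l ih => simp [Finset.sum_add_distrib, ih]

theorem abs_sum_map_le {α : Type*} {l : List α} {f : α → ℝ} {B : ℝ}
    (h : ∀ a ∈ l, |f a| ≤ B) : |(l.map f).sum| ≤ l.length * B := by
  induction l with
  | nil => simp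
  | cons a l ih =>
    simp only [List.map_cons, List.sum_cons, List.length_cons]
    refine (abs_add_le _ _).trans ?_
    have h1 := h a (by simp)
    have h2 := ih fun b hb => h b (by simp [hb])
    push_cast
    linarith

/-- Letters: the index of a matrix, and whether it is transposed. -/
abbrev Letter (d : ℕ) : Type := Fin d × Bool

/-- The letter of the transposed matrix. -/
def Letter.flip {d : ℕ} (l : Letter d) : Letter d := (l.1, !l.2)

theorem Letter.flip_ne {d : ℕ} (l : Letter d) : l.flip ≠ l := fun h => by
  have := congrArg Prod.snd h
  simp [flip] at this

/-- The word of the transposed product. -/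
def revWord {d : ℕ} (w : List (Letter d)) : List (Letter d) := (w.map Letter.flip).reverse

theorem length_revWord {d : ℕ} (w : List (Letter d)) : (revWord w).length = w.length := by
  simp [revWord]

section Words
variable {N d : ℕ}

/-- The variable in position `(i, j)` of the matrix of a letter. -/
def letterEntry (l : Letter d) (i j : Fin N) : Entry N d :=
  .inr (.inl (l.1, if l.2 then (j, i) else (i, j)))

/-- The generic matrix of a letter. -/
def letterMat (N : ℕ) (l : Letter d) : Matrix (Fin N) (Fin N) (Poly N d) :=
  Matrix.of fun i j => MvPolynomial.X (letterEntry l i j)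

theorem letterMat_flip (l : Letter d) : letterMat N l.flip = (letterMat N l)ᵀ := by
  ext1 i j
  obtain ⟨k, _ | _⟩ := l <;> rfl

/-- The product of the generic matrices of a word. -/
def wordMat (N : ℕ) (w : List (Letter d)) : Matrix (Fin N) (Fin N) (Poly N d) :=
  (w.map (letterMat N)).prod

theorem wordMat_append (v w : List (Letter d)) :
    wordMat N (v ++ w) = wordMat N v * wordMat N w := by
  simp [wordMat]

theorem wordMat_cons (l : Letter d) (w : List (Letter d)) :
    wordMat N (l :: w) = letterMat N l * wordMat N w := by
  simp [wordMat]

theorem wordMat_revWord (w : List (Letter d)) : wordMat N (revWord w) = (wordMat N w)ᵀ := by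
  induction w with
  | nil => simp [wordMat, revWord]
  | cons l w ih =>
    have : revWord (l :: w) = revWord w ++ [l.flip] := by simp [revWord]
    rw [this, wordMat_append, ih, wordMat_cons l w, Matrix.transpose_mul, ← letterMat_flip]
    simp [wordMat]

theorem map_pderiv_mul (e : Entry N d) (A B : Matrix (Fin N) (Fin N) (Poly N d)) :
    (A * B).map (MvPolynomial.pderiv e) =
      A.map (MvPolynomial.pderiv e) * B + A * B.map (MvPolynomial.pderiv e) := by
  ext1 i j
  simp only [Matrix.map_apply, Matrix.mul_apply, map_sum, Derivation.leibniz, smul_eq_mul,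
    Matrix.add_apply, ← Finset.sum_add_distrib]
  refine Finset.sum_congr rfl fun r _ => ?_
  ring

/-- Differentiating a generic matrix in one of its own entries gives an elementary matrix,
transposed if the two letters are transposes of each other. -/
theorem map_pderiv_letterMat (l b : Letter d) (i j : Fin N) :
    (letterMat N b).map (MvPolynomial.pderiv (letterEntry l i j)) =
      if b = l then Matrix.single i j 1 else if b = l.flip then Matrix.single j i 1 else 0 := by
  classical
  ext1 r s
  obtain ⟨k, ε⟩ := l
  obtain ⟨k', ε'⟩ := b
  simp only [Matrix.map_apply, letterMat, Matrix.of_apply, MvPolynomial.pderiv_X, Pi.single_apply,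
    letterEntry, Letter.flip, Sum.inr.injEq, Sum.inl.injEq, Prod.mk.injEq]
  cases ε <;> cases ε' <;> by_cases hk : k' = k <;> simp [hk, Matrix.single_apply, and_comm, eq_comm]

/-- Leibniz rule for a noncommutative product: one term for each position of the word. -/
theorem map_pderiv_wordMat (e : Entry N d) (w : List (Letter d)) :
    (wordMat N w).map (MvPolynomial.pderiv e) = ((splits w).map fun s => wordMat N s.1 *
      (letterMat N s.2.1).map (MvPolynomial.pderiv e) * wordMat N s.2.2).sum := by
  induction w with
  | nil =>
    ext1 i j
    simp [wordMat, splits, Matrix.one_apply, apply_ite]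
  | cons l w ih =>
    rw [wordMat_cons, map_pderiv_mul, ih]
    simp only [splits, List.map_cons, List.sum_cons, List.map_map, Function.comp_def,
      wordMat_cons, mul_assoc, List.sum_map_mul_left]
    simp [wordMat]

theorem mul_single_mul_apply {R : Type*} [CommRing R] (P Q : Matrix (Fin N) (Fin N) R)
    (i j r s : Fin N) : (P * Matrix.single i j (1 : R) * Q : Matrix _ _ R) r s = P r i * Q j s := by
  classical
  rw [mul_assoc, Matrix.mul_apply, Finset.sum_eq_single i]
  · simp
  · intro b _ hb
    rw [Matrix.single_mul_apply_of_ne _ _ _ _ _ hb, mul_zero]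
  · simp

theorem trace_mul_single_mul {R : Type*} [CommRing R] (P Q : Matrix (Fin N) (Fin N) R)
    (i j : Fin N) : (P * Matrix.single i j (1 : R) * Q).trace = (Q * P) j i := by
  simp only [Matrix.trace, Matrix.diag, mul_single_mul_apply]
  rw [Matrix.mul_apply]
  exact Finset.sum_congr rfl fun r _ => mul_comm _ _

theorem list_sum_apply {α R : Type*} [AddCommMonoid R] (L : List α)
    (f : α → Matrix (Fin N) (Fin N) R) (i j : Fin N) :
    (L.map f).sum i j = (L.map fun a => f a i j).sum := by
  induction L with
  | nil => simp
  | cons a L ih => simp [ih]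

theorem trace_list_sum {α R : Type*} [AddCommMonoid R] (L : List α)
    (f : α → Matrix (Fin N) (Fin N) R) :
    (L.map f).sum.trace = (L.map fun a => (f a).trace).sum := by
  induction L with
  | nil => simp
  | cons a L ih => simp [ih]

/-- The normalised trace of a word. -/
def ntr (N : ℕ) (w : List (Letter d)) : Poly N d :=
  MvPolynomial.C (N : ℝ)⁻¹ * (wordMat N w).trace

theorem ntr_nil (hN : N ≠ 0) : ntr N ([] : List (Letter d)) = 1 := by
  have : (N : ℝ) ≠ 0 := mod_cast hN
  have h : (N : Poly N d) = MvPolynomial.C (N : ℝ) := by simp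
  simp only [ntr, wordMat, List.map_nil, List.prod_nil, Matrix.trace_one, Fintype.card_fin]
  rw [h, ← map_mul, inv_mul_cancel₀ this, map_one]

theorem sum_apply_mul_apply (P Q : List (Letter d)) :
    ∑ i, ∑ j, wordMat N P j i * wordMat N Q j i = (wordMat N (revWord P ++ Q)).trace := by
  rw [wordMat_append, wordMat_revWord]
  simp [Matrix.trace, Matrix.mul_apply]

theorem sum_apply_mul_apply' (P Q : List (Letter d)) :
    ∑ i, ∑ j, wordMat N P j i * wordMat N Q i j = (wordMat N (P ++ Q)).trace := by
  rw [wordMat_append, Finset.sum_comm]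
  simp [Matrix.trace, Matrix.mul_apply]

/-- The contribution to Stein's identity of a pairing within a trace. -/
def selfPair (N : ℕ) (l : Letter d) (s : List (Letter d) × Letter d × List (Letter d)) :
    Poly N d :=
  if s.2.1 = l then MvPolynomial.C (N : ℝ)⁻¹ * ntr N (revWord s.1 ++ s.2.2)
  else if s.2.1 = l.flip then ntr N s.1 * ntr N s.2.2 else 0

/-- The contribution to Stein's identity of a pairing between two traces. -/
def crossPair (N : ℕ) (l : Letter d) (M : List (Letter d))
    (s : List (Letter d) × Letter d × List (Letter d)) : Poly N d :=
  if s.2.1 = l then ntr N (revWord M ++ (s.2.2 ++ s.1))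
  else if s.2.1 = l.flip then ntr N (M ++ (s.2.2 ++ s.1)) else 0

/-- Contracting the indices `i, j`: an equal letter closes one trace, of `PᵀQ`, so one of the two
factors `1/N` is left over; a transposed letter closes two traces, which use up both factors. -/
theorem sum_pderiv_wordMat (l : Letter d) (M : List (Letter d)) :
    MvPolynomial.C ((N : ℝ)⁻¹ * (N : ℝ)⁻¹) *
        ∑ i, ∑ j, MvPolynomial.pderiv (letterEntry l i j) (wordMat N M j i) =
      ((splits M).map (selfPair N l)).sum := by
  have h : ∀ i j, MvPolynomial.pderiv (letterEntry l i j) (wordMat N M j i) =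
      ((splits M).map fun s => if s.2.1 = l then wordMat N s.1 j i * wordMat N s.2.2 j i
        else if s.2.1 = l.flip then wordMat N s.1 j j * wordMat N s.2.2 i i else 0).sum := by
    intro i j
    rw [← Matrix.map_apply (f := MvPolynomial.pderiv (letterEntry l i j)), map_pderiv_wordMat,
      list_sum_apply]
    congr 1
    refine List.map_congr_left fun s _ => ?_
    rw [map_pderiv_letterMat]
    split_ifs <;> simp [mul_single_mul_apply]
  simp only [h, sum_sum_map]
  rw [← List.sum_map_mul_left]
  congr 1
  refine List.map_congr_left fun s _ => ?_
  unfold selfPair ntr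
  split_ifs
  · rw [sum_apply_mul_apply, map_mul]
    ring
  · rw [Finset.sum_comm, ← Finset.sum_mul_sum, map_mul]
    simp only [Matrix.trace, Matrix.diag]
    ring
  · simp

/-- A pairing with a letter of another trace fuses the two traces. By cyclicity the cut word is read
as `s.2.2 ++ s.1`. -/
theorem sum_wordMat_mul_pderiv_ntr (l : Letter d) (M u : List (Letter d)) :
    ∑ i, ∑ j, wordMat N M j i * MvPolynomial.pderiv (letterEntry l i j) (ntr N u) =
      ((splits u).map (crossPair N l M)).sum := by
  have h : ∀ i j, MvPolynomial.pderiv (letterEntry l i j) (ntr N u) =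
      MvPolynomial.C (N : ℝ)⁻¹ * ((splits u).map fun s =>
        if s.2.1 = l then wordMat N (s.2.2 ++ s.1) j i
        else if s.2.1 = l.flip then wordMat N (s.2.2 ++ s.1) i j else 0).sum := by
    intro i j
    have htr : MvPolynomial.pderiv (letterEntry l i j) (wordMat N u).trace =
        ((wordMat N u).map (MvPolynomial.pderiv (letterEntry l i j))).trace := by
      simp [Matrix.trace]
    rw [ntr, MvPolynomial.pderiv_C_mul, htr, map_pderiv_wordMat, trace_list_sum]
    congr 2
    refine List.map_congr_left fun s _ => ?_
    rw [map_pderiv_letterMat]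
    split_ifs <;> simp [trace_mul_single_mul, wordMat_append]
  simp only [h, ← List.sum_map_mul_left, sum_sum_map]
  congr 1
  refine List.map_congr_left fun s _ => ?_
  unfold crossPair ntr
  split_ifs
  · rw [← sum_apply_mul_apply]
    simp only [Finset.mul_sum]
    refine Finset.sum_congr rfl fun i _ => Finset.sum_congr rfl fun j _ => ?_
    ring
  · rw [← sum_apply_mul_apply']
    simp only [Finset.mul_sum]
    refine Finset.sum_congr rfl fun i _ => Finset.sum_congr rfl fun j _ => ?_
    ring
  · simp

end Words

/-! ### Limits of normalised traces: noncrossing pairings -/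

theorem sum_map_sub {α : Type*} (L : List α) (f g : α → ℝ) :
    (L.map fun a => f a - g a).sum = (L.map f).sum - (L.map g).sum := by
  induction L with
  | nil => simp
  | cons a L ih =>
    simp only [List.map_cons, List.sum_cons, ih]
    ring

/-- The limit of the expected normalised trace of a word: the sum over its noncrossing pairings
of a matrix with its transpose. -/
def limTr {d : ℕ} (v : ℝ) : List (Letter d) → ℝ
  | [] => 1
  | l :: M => v * ((splits M).attach.map fun s =>
      if s.1.2.1 = l.flip then limTr v s.1.1 * limTr v s.1.2.2 else 0).sum
termination_by w => w.length
decreasing_by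
  all_goals
    have := length_of_mem_splits s.2
    simp only [List.length_cons]
    omega

theorem limTr_cons {d : ℕ} (v : ℝ) (l : Letter d) (M : List (Letter d)) :
    limTr v (l :: M) = v * ((splits M).map fun s =>
      if s.2.1 = l.flip then limTr v s.1 * limTr v s.2.2 else 0).sum := by
  rw [limTr]
  congr 2
  exact List.attach_map_val (f := fun s : List (Letter d) × Letter d × List (Letter d) =>
    if s.2.1 = l.flip then limTr v s.1 * limTr v s.2.2 else 0)

/-- A pairing joins a letter to its transpose, which is absent if all letters have the same
orientation. -/
theorem limTr_eq_zero_of_forall_snd {d : ℕ} (v : ℝ) (b : Bool) {w : List (Letter d)}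
    (h : ∀ l ∈ w, l.2 = b) (hw : w ≠ []) : limTr v w = 0 := by
  cases w with
  | nil => exact absurd rfl hw
  | cons l M =>
    rw [limTr_cons]
    convert mul_zero v
    refine List.sum_eq_zero fun x hx => ?_
    obtain ⟨s, hs, rfl⟩ := List.mem_map.1 hx
    refine if_neg fun hl => ?_
    have h1 := h l (by simp)
    have h2 := h s.2.1 (by simp [eq_of_mem_splits hs])
    rw [hl] at h2
    simp [Letter.flip, h1] at h2

/-- Only the nested pairing survives. If the first letter were paired before the end, the letters
after its partner would form a nonempty word of untransposed letters, with limit zero; so it is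
paired with the last letter, and induction treats what lies between. -/
theorem limTr_map_true_append_map_false {d : ℕ} (v : ℝ) (p q : List (Fin d)) :
    limTr v (p.map (·, true) ++ (q.map (·, false)).reverse) =
      if p = q then v ^ p.length else 0 := by
  induction p generalizing q with
  | nil =>
    cases q with
    | nil => simp [limTr]
    | cons k q =>
      rw [if_neg (by simp)]
      refine limTr_eq_zero_of_forall_snd v false ?_ (by simp)
      simp only [List.map_nil, List.nil_append, List.mem_reverse, List.mem_map]
      rintro l ⟨k, -, rfl⟩
      rfl
  | cons k p ih =>
    cases q with
    | nil =>
      rw [if_neg (by simp)]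
      refine limTr_eq_zero_of_forall_snd v true ?_ (by simp)
      simp only [List.map_nil, List.reverse_nil, List.append_nil, List.mem_map]
      rintro l ⟨k, -, rfl⟩
      rfl
    | cons k' q =>
      simp only [List.map_cons, List.cons_append, List.reverse_cons]
      rw [limTr_cons, ← List.append_assoc, splits_append, List.map_append, List.sum_append]
      have h0 : ((List.map (fun s : List (Letter d) × Letter d × List (Letter d) =>
          (s.1, s.2.1, s.2.2 ++ [(k', false)]))
          (splits (p.map (·, true) ++ (q.map (·, false)).reverse))).map fun s =>
            if s.2.1 = Letter.flip (k, true) then limTr v s.1 * limTr v s.2.2 else 0).sum = 0 := by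
        refine List.sum_eq_zero fun x hx => ?_
        obtain ⟨s, hs, rfl⟩ := List.mem_map.1 hx
        obtain ⟨s, hs', rfl⟩ := List.mem_map.1 hs
        simp only
        split_ifs with hl
        · convert mul_zero _
          refine limTr_eq_zero_of_forall_snd v false ?_ (by simp)
          rw [splits_append, List.mem_append] at hs'
          rcases hs' with hs' | hs'
          · obtain ⟨t, ht, rfl⟩ := List.mem_map.1 hs'
            have hmem : t.2.1 ∈ p.map (·, true) := by
              rw [eq_of_mem_splits ht]
              simp
            obtain ⟨a, -, ha⟩ := List.mem_map.1 hmem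
            simp [← ha, Letter.flip] at hl
          · obtain ⟨t, ht, rfl⟩ := List.mem_map.1 hs'
            intro a ha
            rw [List.mem_append, List.mem_singleton] at ha
            rcases ha with ha | rfl
            · have hmem : a ∈ (q.map (·, false)).reverse := by
                rw [eq_of_mem_splits ht]
                simp [show a ∈ t.2.2 from ha]
              obtain ⟨a, -, rfl⟩ := List.mem_map.1 (List.mem_reverse.1 hmem)
              rfl
            · rfl
        · rfl
      rw [h0, zero_add]
      simp only [splits, List.map_nil, List.map_cons, List.append_nil, List.sum_cons,
        List.sum_nil, add_zero, ih, limTr, mul_one, Letter.flip, Prod.mk.injEq, List.cons.injEq,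
        List.length_cons, pow_succ', Bool.not_true, and_true]
      by_cases hk : k' = k
      · subst hk
        by_cases hp : p = q <;> simp [hp]
      · simp [hk, Ne.symm hk]

/-! ### Moment bounds and asymptotic factorisation of traces -/

/-- The bound of the expected products of normalised traces of given total length. -/
def momBd (v : ℝ) : ℕ → ℝ
  | 0 => 1
  | 1 => 1
  | n + 2 => v * ((n + 1) * momBd v n)

theorem momBd_nonneg {v : ℝ} (hv : 0 ≤ v) : ∀ n, 0 ≤ momBd v n
  | 0 => zero_le_one
  | 1 => zero_le_one
  | n + 2 => by
    have := momBd_nonneg hv n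
    rw [momBd]
    positivity

theorem momBd_two_mul_le {v : ℝ} (hv : 0 ≤ v) (n : ℕ) :
    momBd v (2 * n) ≤ (2 * v) ^ n * n.factorial := by
  induction n with
  | zero => simp [momBd]
  | succ n ih =>
    have h0 := momBd_nonneg hv (2 * n)
    rw [Nat.mul_succ, momBd, Nat.factorial_succ, pow_succ]
    push_cast
    calc v * ((2 * n + 1) * momBd v (2 * n)) ≤ v * ((2 * (n + 1)) * momBd v (2 * n)) := by
          gcongr
          linarith
      _ ≤ v * ((2 * (n + 1)) * ((2 * v) ^ n * n.factorial)) := by gcongr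
      _ = _ := by ring

/-- This is the step of the moment recursion: remove a letter, choose one of `n` partners, keep
total length `n - 1`. For `n = 0` there is no partner, and the factor `n` makes the truncated
subtraction harmless. -/
theorem mul_momBd_pred_le {v : ℝ} (n : ℕ) :
    v * (n * momBd v (n - 1)) ≤ momBd v (n + 1) := by
  cases n with
  | zero => simp [momBd]
  | succ n => simp [momBd]

section Wick
variable {N d : ℕ}

/-- The product of the normalised traces of a list of words. -/
def prodTr (N : ℕ) (ws : List (List (Letter d))) : Poly N d := (ws.map (ntr N)).prod

theorem prodTr_cons (w : List (Letter d)) (ws : List (List (Letter d))) :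
    prodTr N (w :: ws) = ntr N w * prodTr N ws := by
  simp [prodTr]

theorem prodTr_append (ws ws' : List (List (Letter d))) :
    prodTr N (ws ++ ws') = prodTr N ws * prodTr N ws' := by
  simp [prodTr]

/-- The total length of a list of words. -/
def totLen (ws : List (List (Letter d))) : ℕ := (ws.map List.length).sum

theorem totLen_cons (w : List (Letter d)) (ws : List (List (Letter d))) :
    totLen (w :: ws) = w.length + totLen ws := by
  simp [totLen]

theorem totLen_append (ws ws' : List (List (Letter d))) :
    totLen (ws ++ ws') = totLen ws + totLen ws' := by
  simp [totLen]

/-- The contraction of the gradient of a polynomial with a word. -/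
def crossSum (l : Letter d) (M : List (Letter d)) (p : Poly N d) : Poly N d :=
  ∑ i, ∑ j, wordMat N M j i * MvPolynomial.pderiv (letterEntry l i j) p

theorem crossSum_mul (l : Letter d) (M : List (Letter d)) (p q : Poly N d) :
    crossSum l M (p * q) = crossSum l M p * q + p * crossSum l M q := by
  simp only [crossSum, Finset.sum_mul, Finset.mul_sum, ← Finset.sum_add_distrib]
  refine Finset.sum_congr rfl fun i _ => Finset.sum_congr rfl fun j _ => ?_
  rw [Derivation.leibniz, smul_eq_mul, smul_eq_mul]
  ring

theorem map_C_mul (E : Poly N d →ₗ[ℝ] ℝ) (c : ℝ) (p : Poly N d) :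
    E (MvPolynomial.C c * p) = c * E p := by
  rw [← MvPolynomial.smul_eq_C_mul, map_smul, smul_eq_mul]

theorem map_list_sum_mul {α : Type*} (E : Poly N d →ₗ[ℝ] ℝ) (L : List α) (f : α → Poly N d)
    (p : Poly N d) : E ((L.map f).sum * p) = (L.map fun a => E (f a * p)).sum := by
  induction L with
  | nil => simp
  | cons a L ih => simp [add_mul, ih]

variable {E : Poly N d →ₗ[ℝ] ℝ} {var : Entry N d → ℝ} {v : ℝ}

/-- Stein's identity for a product with a normalised trace. -/
theorem IsWick.map_ntr_cons_mul (hE : IsWick E var)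
    (hvar : ∀ l i j, var (letterEntry l i j) = v * (N : ℝ)⁻¹) (l : Letter d)
    (M : List (Letter d)) (R : Poly N d) :
    E (ntr N (l :: M) * R) = v * (((splits M).map fun s => E (selfPair N l s * R)).sum +
      (N : ℝ)⁻¹ * (N : ℝ)⁻¹ * E (crossSum l M R)) := by
  have h1 : ntr N (l :: M) * R = MvPolynomial.C (N : ℝ)⁻¹ *
      ∑ i, ∑ j, MvPolynomial.X (letterEntry l i j) * (wordMat N M j i * R) := by
    rw [ntr, wordMat_cons, Matrix.trace, mul_assoc]
    congr 1
    simp only [Matrix.diag, Matrix.mul_apply, Finset.sum_mul, letterMat, Matrix.of_apply,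
      mul_assoc]
  have h2 : ∀ i j, E (MvPolynomial.X (letterEntry l i j) * (wordMat N M j i * R)) =
      v * (N : ℝ)⁻¹ * E (MvPolynomial.pderiv (letterEntry l i j) (wordMat N M j i) * R +
        wordMat N M j i * MvPolynomial.pderiv (letterEntry l i j) R) := by
    intro i j
    rw [hE.stein, hvar, Derivation.leibniz, smul_eq_mul, smul_eq_mul]
    congr 2
    ring
  rw [h1, map_C_mul]
  simp only [map_sum, h2, ← Finset.mul_sum]
  simp only [← map_sum, Finset.sum_add_distrib, ← Finset.sum_mul]
  rw [← map_list_sum_mul, ← sum_pderiv_wordMat, mul_assoc (MvPolynomial.C _), map_C_mul, map_add,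
    crossSum]
  ring

/-- By Leibniz the gradient hits one word of `R` at a time, and the words already passed are stored
in `Z`. Each letter of `R` gives at most one fused word, which leaves a list of total length `n -
1`, to which `β` applies. -/
theorem abs_map_crossSum_le (E : Poly N d →ₗ[ℝ] ℝ) (l : Letter d) (M : List (Letter d)) {n : ℕ}
    {β : ℝ} (hβ0 : 0 ≤ β) (hβ : ∀ ws, totLen ws + 1 = n → |E (prodTr N ws)| ≤ β)
    (R Z : List (List (Letter d))) (h : M.length + totLen R + totLen Z = n) :
    |E (crossSum l M (prodTr N R) * prodTr N Z)| ≤ totLen R * β := by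
  induction R generalizing Z with
  | nil => simp [crossSum, prodTr, totLen]
  | cons u R ih =>
    have hu : crossSum l M (ntr N u) = ((splits u).map (crossPair N l M)).sum :=
      sum_wordMat_mul_pderiv_ntr l M u
    have h1 : crossSum l M (prodTr N (u :: R)) * prodTr N Z =
        ((splits u).map (crossPair N l M)).sum * prodTr N (R ++ Z) +
          crossSum l M (prodTr N R) * prodTr N (u :: Z) := by
      rw [prodTr_cons, crossSum_mul, hu, prodTr_append, prodTr_cons]
      ring
    rw [totLen_cons] at h
    rw [h1, map_add, map_list_sum_mul, totLen_cons]
    have h2 := ih (u :: Z) (by rw [totLen_cons]; omega)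
    have h3 : |((splits u).map fun s => E (crossPair N l M s * prodTr N (R ++ Z))).sum| ≤
        (splits u).length * β := by
      refine abs_sum_map_le fun s hs => ?_
      have hlen := length_of_mem_splits hs
      unfold crossPair
      split_ifs
      · rw [← prodTr_cons]
        refine hβ _ ?_
        simp only [totLen_cons, totLen_append, List.length_append, length_revWord]
        omega
      · rw [← prodTr_cons]
        refine hβ _ ?_
        simp only [totLen_cons, totLen_append, List.length_append]
        omega
      · simpa using hβ0
    rw [length_splits] at h3
    refine (abs_add_le _ _).trans ?_
    push_cast
    linarith

/-- The expected product of normalised traces is bounded independently of the dimension, and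
factorizes up to an error of order `1 / N`. -/
theorem IsWick.abs_map_prodTr_le (hE : IsWick E var) (hN : N ≠ 0) (hv : 0 ≤ v)
    (hvar : ∀ l i j, var (letterEntry l i j) = v * (N : ℝ)⁻¹) (n : ℕ) :
    ∀ ws : List (List (Letter d)), totLen ws = n → |E (prodTr N ws)| ≤ momBd v n ∧
      |E (prodTr N ws) - (ws.map (limTr v)).prod| ≤ momBd v n * (N : ℝ)⁻¹ := by
  have hN1 : (N : ℝ)⁻¹ ≤ 1 := inv_le_one_of_one_le₀ (mod_cast Nat.one_le_iff_ne_zero.2 hN)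
  have hN0 : 0 ≤ (N : ℝ)⁻¹ := by positivity
  induction n using Nat.strong_induction_on with
  | _ n IH =>
  intro ws
  -- The inner induction on the list only removes empty words, whose normalised trace is `1` and
  -- which do not change the total length.
  induction ws with
  | nil =>
    rintro rfl
    simp [prodTr, totLen, momBd, hE.map_one]
  | cons w R ihR =>
    intro hn
    rw [totLen_cons] at hn
    rw [prodTr_cons]
    cases w with
    | nil => simpa [ntr_nil hN, limTr] using ihR (by simpa using hn)
    | cons l M =>
      obtain ⟨m, rfl⟩ : ∃ m, n = m + 1 := ⟨M.length + totLen R, by simp at hn; omega⟩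
      have hm : M.length + totLen R = m := by simp at hn; omega
      set β := momBd v (m - 1) with hβ
      have hβ0 : 0 ≤ β := momBd_nonneg hv _
      have hIH : ∀ ws, totLen ws + 1 = m → |E (prodTr N ws)| ≤ β ∧
          |E (prodTr N ws) - (ws.map (limTr v)).prod| ≤ β * (N : ℝ)⁻¹ := by
        intro ws hws
        exact IH (m - 1) (by omega) ws (by omega)
      have hcross : |E (crossSum l M (prodTr N R))| ≤ totLen R * β := by
        have := abs_map_crossSum_le E l M hβ0 (fun ws hws => (hIH ws hws).1) R []
          (by simpa [totLen] using hm)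
        simpa [prodTr] using this
      have hself : ∀ s ∈ splits M, |E (selfPair N l s * prodTr N R)| ≤ β ∧
          |E (selfPair N l s * prodTr N R) - (if s.2.1 = l.flip then
            limTr v s.1 * limTr v s.2.2 else 0) * (R.map (limTr v)).prod| ≤ β * (N : ℝ)⁻¹ := by
        intro s hs
        have hlen := length_of_mem_splits hs
        -- An equal letter carries an explicit `1/N` and is pure error; a transposed letter splits
        -- the trace and reproduces the recursion of `limTr`; any other letter gives zero.
        by_cases h1 : s.2.1 = l
        · have h2 : s.2.1 ≠ l.flip := fun h => l.flip_ne (h.symm.trans h1)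
          have h3 := (hIH ((revWord s.1 ++ s.2.2) :: R) (by
            simp only [totLen_cons, List.length_append, length_revWord]
            omega)).1
          rw [if_neg h2, selfPair, if_pos h1, mul_assoc, ← prodTr_cons, map_C_mul, zero_mul,
            sub_zero, abs_mul, abs_of_nonneg hN0, mul_comm]
          have h4 := mul_le_mul_of_nonneg_right h3 hN0
          exact ⟨h4.trans (mul_le_of_le_one_right hβ0 hN1), h4⟩
        · by_cases h2 : s.2.1 = l.flip
          · have h3 := hIH (s.1 :: s.2.2 :: R) (by
              simp only [totLen_cons]
              omega)
            rw [if_pos h2, selfPair, if_neg h1, if_pos h2, mul_assoc, mul_assoc, ← prodTr_cons,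
              ← prodTr_cons]
            simpa using h3
          · rw [if_neg h2, selfPair, if_neg h1, if_neg h2]
            simp only [zero_mul, map_zero, abs_zero, sub_zero]
            exact ⟨hβ0, by positivity⟩
      have hstep := mul_momBd_pred_le (v := v) m
      rw [← hβ] at hstep
      have hmR : (m : ℝ) = M.length + totLen R := by rw [← hm]; push_cast; ring
      have hsum1 := abs_sum_map_le fun s hs => (hself s hs).1
      have hsum2 := abs_sum_map_le fun s hs => (hself s hs).2
      rw [length_splits] at hsum1 hsum2
      -- Pairings between different traces are of order `1/N²`; `1/N` is enough here.
      have hcr : |(N : ℝ)⁻¹ * (N : ℝ)⁻¹ * E (crossSum l M (prodTr N R))| ≤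
          (N : ℝ)⁻¹ * (totLen R * β) := by
        rw [abs_mul, abs_of_nonneg (mul_nonneg hN0 hN0)]
        calc _ ≤ (N : ℝ)⁻¹ * 1 * (totLen R * β) := by gcongr
          _ = _ := by ring
      rw [hE.map_ntr_cons_mul hvar]
      constructor
      · rw [abs_mul, abs_of_nonneg hv]
        refine le_trans (mul_le_mul_of_nonneg_left ?_ hv) hstep
        refine (abs_add_le _ _).trans ((add_le_add hsum1 hcr).trans ?_)
        rw [hmR, add_mul]
        exact add_le_add_right (mul_le_of_le_one_left (by positivity) hN1) _
      · have hsub : ((splits M).map fun s => E (selfPair N l s * prodTr N R) -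
            (if s.2.1 = l.flip then limTr v s.1 * limTr v s.2.2 else 0) *
              (R.map (limTr v)).prod).sum =
            ((splits M).map fun s => E (selfPair N l s * prodTr N R)).sum -
            ((splits M).map fun s => if s.2.1 = l.flip then limTr v s.1 * limTr v s.2.2
              else 0).sum * (R.map (limTr v)).prod := by
          rw [← List.sum_map_mul_right]
          exact sum_map_sub (splits M) _ _
        rw [List.map_cons, List.prod_cons, limTr_cons, mul_assoc v, ← mul_sub, abs_mul,
          abs_of_nonneg hv, add_sub_right_comm, ← hsub]
        refine le_trans (mul_le_mul_of_nonneg_left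
          ((abs_add_le _ _).trans (add_le_add hsum2 hcr)) hv) ?_
        calc v * (M.length * (β * (N : ℝ)⁻¹) + (N : ℝ)⁻¹ * (totLen R * β))
            = v * (m * β) * (N : ℝ)⁻¹ := by rw [hmR]; ring
          _ ≤ _ := mul_le_mul_of_nonneg_right hstep hN0

end Wick

/-! ### Bilinear forms of words in the Gaussian sources -/

section QuadForm
variable {N d : ℕ}

/-- The variable of a component of a source. -/
def srcEntry (c : Option (Fin d)) (i : Fin N) : Entry N d :=
  c.elim (.inl i) fun k => .inr (.inr (k, i))

theorem srcEntry_inj {c c' : Option (Fin d)} {i i' : Fin N} :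
    srcEntry c i = srcEntry c' i' ↔ c = c' ∧ i = i' := by
  cases c <;> cases c' <;> simp [srcEntry]

/-- A component of a generic source. -/
def srcPoly (c : Option (Fin d)) (i : Fin N) : Poly N d := MvPolynomial.X (srcEntry c i)

theorem pderiv_srcPoly (c c' : Option (Fin d)) (i i' : Fin N) :
    MvPolynomial.pderiv (srcEntry c i) (srcPoly c' i') = if c = c' ∧ i = i' then 1 else 0 := by
  classical
  rw [srcPoly, MvPolynomial.pderiv_X, Pi.single_apply]
  refine if_congr ?_ rfl rfl
  rw [srcEntry_inj]
  constructor <;> rintro ⟨rfl, rfl⟩ <;> exact ⟨rfl, rfl⟩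

theorem pderiv_srcEntry_wordMat (c : Option (Fin d)) (r i j : Fin N) (w : List (Letter d)) :
    MvPolynomial.pderiv (srcEntry c r) (wordMat N w i j) = 0 := by
  have h : ∀ b : Letter d, (letterMat N b).map (MvPolynomial.pderiv (srcEntry c r)) = 0 := by
    intro b
    ext1 i j
    refine MvPolynomial.pderiv_X_of_ne ?_
    cases c <;> simp [letterEntry, srcEntry]
  rw [← Matrix.map_apply (f := MvPolynomial.pderiv (srcEntry c r)), map_pderiv_wordMat,
    list_sum_apply]
  exact List.sum_eq_zero fun x hx => by
    obtain ⟨s, -, rfl⟩ := List.mem_map.1 hx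
    simp [h]

/-- The normalised bilinear form of a word, at two sources. -/
def quadForm (N : ℕ) (c : Option (Fin d)) (M : List (Letter d)) (c' : Option (Fin d)) :
    Poly N d :=
  MvPolynomial.C (N : ℝ)⁻¹ * ∑ i, ∑ j, srcPoly c i * (srcPoly c' j * wordMat N M i j)

variable {E : Poly N d →ₗ[ℝ] ℝ} {var : Entry N d → ℝ} {v : ℝ} {sv : Option (Fin d) → ℝ}

/-- The factor `A` does not involve the sources, so Stein's identity treats it as a constant. -/
theorem IsWick.map_two (hE : IsWick E var) (hsv : ∀ c i, var (srcEntry c i) = sv c)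
    {A : Poly N d} (hA : ∀ c i, MvPolynomial.pderiv (srcEntry c i) A = 0)
    (c c' : Option (Fin d)) (i j : Fin N) :
    E (srcPoly c i * (srcPoly c' j * A)) =
      if c = c' then sv c * (if i = j then E A else 0) else 0 := by
  rw [srcPoly, hE.stein, Derivation.leibniz, hA, pderiv_srcPoly, hsv]
  by_cases hc : c = c' <;> by_cases hi : i = j <;> simp [hc, hi]

/-- Wick's formula with three pairings. The pairing of `i` with `k` and `j` with `l` is always
available; the other two join `c` to `c'` and require equality. -/
theorem IsWick.map_four (hE : IsWick E var) (hsv : ∀ c i, var (srcEntry c i) = sv c)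
    {A : Poly N d} (hA : ∀ c i, MvPolynomial.pderiv (srcEntry c i) A = 0)
    (c c' : Option (Fin d)) (i j k l : Fin N) :
    E (srcPoly c i * (srcPoly c' j * (srcPoly c k * (srcPoly c' l * A)))) =
      sv c * (sv c' * (if i = k then (if j = l then E A else 0) else 0) +
        if c = c' then sv c * ((if i = j then (if k = l then E A else 0) else 0) +
          (if i = l then (if j = k then E A else 0) else 0)) else 0) := by
  have h2 := hE.map_two hsv hA
  have h : MvPolynomial.pderiv (srcEntry c i)
      (srcPoly c' j * (srcPoly c k * (srcPoly c' l * A))) =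
      (if i = k then srcPoly c' j * (srcPoly c' l * A) else 0) +
      if c = c' then ((if i = j then srcPoly c k * (srcPoly c' l * A) else 0) +
        if i = l then srcPoly c' j * (srcPoly c k * A) else 0) else 0 := by
    simp only [Derivation.leibniz, hA, pderiv_srcPoly, smul_eq_mul]
    by_cases hc : c = c'
    · subst hc
      simp only [true_and, if_true]
      split_ifs <;> ring
    · simp only [hc, true_and, false_and, if_false]
      split_ifs <;> ring
  rw [srcPoly, hE.stein, hsv, h]
  congr 1
  rw [map_add]
  congr 1
  · split_ifs with h1 h3
    · rw [h2, if_pos rfl, if_pos h3]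
    · rw [h2, if_pos rfl, if_neg h3]
    · simp
  · by_cases hc : c = c'
    · subst hc
      simp only [if_true, map_add, apply_ite E, map_zero, h2, mul_add, mul_ite, mul_zero]
    · simp [hc]

theorem IsWick.map_quadForm (hE : IsWick E var) (hsv : ∀ c i, var (srcEntry c i) = sv c)
    (c c' : Option (Fin d)) (M : List (Letter d)) :
    E (quadForm N c M c') = if c = c' then sv c * E (ntr N M) else 0 := by
  rw [quadForm, map_C_mul]
  simp only [map_sum, hE.map_two hsv fun c r => pderiv_srcEntry_wordMat c r _ _ M]
  split_ifs
  · rw [ntr, map_C_mul, Matrix.trace, map_sum]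
    simp only [← Finset.mul_sum, Finset.sum_ite_eq, Finset.mem_univ, if_true, Matrix.diag]
    ring
  · simp

/-- Of the three pairings, only the one internal to each factor keeps two free index sums and is of
order one; the others close a single trace, of `MᵀM` or `MM`, and cost `1/N`. -/
theorem IsWick.map_quadForm_sq (hE : IsWick E var) (hsv : ∀ c i, var (srcEntry c i) = sv c)
    (c c' : Option (Fin d)) (M : List (Letter d)) :
    E (quadForm N c M c' ^ 2) = sv c * (sv c' * ((N : ℝ)⁻¹ * E (ntr N (revWord M ++ M))) +
      if c = c' then sv c * (E (ntr N M * ntr N M) + (N : ℝ)⁻¹ * E (ntr N (M ++ M))) else 0) := by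
  have h1 : quadForm N c M c' ^ 2 = MvPolynomial.C ((N : ℝ)⁻¹ * (N : ℝ)⁻¹) *
      ∑ i, ∑ j, ∑ k, ∑ l, srcPoly c i * (srcPoly c' j * (srcPoly c k * (srcPoly c' l *
        (wordMat N M i j * wordMat N M k l)))) := by
    rw [quadForm, mul_pow, sq (∑ i, _), Finset.sum_mul, sq, ← map_mul]
    congr 1
    refine Finset.sum_congr rfl fun i _ => ?_
    rw [Finset.sum_mul]
    refine Finset.sum_congr rfl fun j _ => ?_
    rw [Finset.mul_sum]
    refine Finset.sum_congr rfl fun k _ => ?_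
    rw [Finset.mul_sum]
    refine Finset.sum_congr rfl fun l _ => ?_
    ring
  have hA : ∀ i j k l, ∀ c r, MvPolynomial.pderiv (srcEntry c r)
      (wordMat N M i j * wordMat N M k l) = 0 := fun i j k l c r => by
    rw [Derivation.leibniz, pderiv_srcEntry_wordMat, pderiv_srcEntry_wordMat]
    simp
  rw [h1, map_C_mul]
  simp only [map_sum, hE.map_four hsv (hA _ _ _ _)]
  have h3 : (wordMat N (revWord M ++ M)).trace =
      ∑ i, ∑ j, wordMat N M i j * wordMat N M i j := by
    rw [← sum_apply_mul_apply, Finset.sum_comm]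
  have h4 : (wordMat N (M ++ M)).trace = ∑ i, ∑ j, wordMat N M i j * wordMat N M j i := by
    rw [← sum_apply_mul_apply', Finset.sum_comm]
  simp only [ntr, h3, h4, map_C_mul, map_sum]
  have h2 : ∀ p q : Poly N d, E (MvPolynomial.C (N : ℝ)⁻¹ * p * (MvPolynomial.C (N : ℝ)⁻¹ * q)) =
      (N : ℝ)⁻¹ * (N : ℝ)⁻¹ * E (p * q) := fun p q => by
    rw [mul_assoc, map_C_mul, mul_left_comm, map_C_mul, mul_assoc]
  rw [h2, Matrix.trace, Finset.sum_mul_sum]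
  simp only [map_sum, Matrix.diag]
  split_ifs
  · simp only [← Finset.mul_sum, Finset.sum_add_distrib]
    simp only [Finset.sum_ite_eq, Finset.mem_univ, if_true, Finset.sum_const_zero,
      Finset.sum_ite_irrel]
    ring
  · simp only [← Finset.mul_sum, Finset.sum_add_distrib]
    simp only [Finset.sum_ite_eq, Finset.mem_univ, if_true, Finset.sum_const_zero,
      Finset.sum_ite_irrel]
    ring

/-- The mean square distance of a normalised bilinear form to its limit. -/
theorem IsWick.map_quadForm_sub_sq_le (hE : IsWick E var) (hN : N ≠ 0) (hv : 0 ≤ v)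
    (hvar : ∀ l i j, var (letterEntry l i j) = v * (N : ℝ)⁻¹)
    (hsv : ∀ c i, var (srcEntry c i) = sv c) {B : ℝ} (hsv0 : ∀ c, 0 ≤ sv c)
    (hsvB : ∀ c, sv c ≤ B) (c c' : Option (Fin d)) (M : List (Letter d)) :
    E ((quadForm N c M c' - MvPolynomial.C (if c = c' then sv c * limTr v M else 0)) ^ 2) ≤
      B ^ 2 * (3 * momBd v (2 * M.length) + 2 * (|limTr v M| * momBd v M.length)) *
        (N : ℝ)⁻¹ := by
  have hw := hE.abs_map_prodTr_le hN hv hvar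
  have hN0 : 0 ≤ (N : ℝ)⁻¹ := by positivity
  have hb := momBd_nonneg hv
  have h1 : |E (ntr N (revWord M ++ M))| ≤ momBd v (2 * M.length) := by
    have := (hw _ [revWord M ++ M] rfl).1
    simpa [prodTr, totLen, length_revWord, two_mul] using this
  have h2 : |E (ntr N (M ++ M))| ≤ momBd v (2 * M.length) := by
    have := (hw _ [M ++ M] rfl).1
    simpa [prodTr, totLen, two_mul] using this
  have h3 : |E (ntr N M * ntr N M) - limTr v M * limTr v M| ≤
      momBd v (2 * M.length) * (N : ℝ)⁻¹ := by
    have := (hw _ [M, M] rfl).2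
    simpa [prodTr, totLen, two_mul] using this
  have h4 : |E (ntr N M) - limTr v M| ≤ momBd v M.length * (N : ℝ)⁻¹ := by
    have := (hw _ [M] rfl).2
    simpa [prodTr, totLen] using this
  have hexp : ∀ a : ℝ, E ((quadForm N c M c' - MvPolynomial.C a) ^ 2) =
      E (quadForm N c M c' ^ 2) - 2 * a * E (quadForm N c M c') + a ^ 2 := by
    intro a
    have : (quadForm N c M c' - MvPolynomial.C a) ^ 2 = quadForm N c M c' ^ 2 -
        MvPolynomial.C (2 * a) * quadForm N c M c' + MvPolynomial.C (a ^ 2) * 1 := by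
      rw [map_mul, map_pow, map_ofNat]
      ring
    rw [this, map_add, map_sub, map_C_mul, map_C_mul, hE.map_one, mul_one]
  have hB : ∀ c c', sv c * sv c' ≤ B ^ 2 := fun c c' => by
    rw [sq]
    exact mul_le_mul (hsvB c) (hsvB c') (hsv0 c') ((hsv0 c).trans (hsvB c))
  rw [hexp, hE.map_quadForm_sq hsv, hE.map_quadForm hsv]
  set b := momBd v (2 * M.length)
  set b' := momBd v M.length
  have hb0 : 0 ≤ b := hb _
  have hb0' : 0 ≤ b' := hb _
  by_cases hc : c = c'
  · subst hc
    simp only [if_true]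
    set L := limTr v M
    -- The second moment is regrouped so that only deviations from `L` remain. Three errors are of
    -- size `b/N` (factorisation and the two single traces), and this one is of size `2|L|b'/N`.
    have h5 : -(2 * L * (E (ntr N M) - L)) ≤ 2 * |L| * (b' * (N : ℝ)⁻¹) := by
      refine (neg_le_abs _).trans ?_
      rw [abs_mul, abs_mul, abs_of_pos two_pos]
      gcongr
    have h6 := (le_abs_self _).trans h3
    have h7 := mul_le_mul_of_nonneg_left ((le_abs_self _).trans h1) hN0
    have h8 := mul_le_mul_of_nonneg_left ((le_abs_self _).trans h2) hN0
    calc _ = sv c * sv c * ((E (ntr N M * ntr N M) - L * L) + -(2 * L * (E (ntr N M) - L)) +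
          (N : ℝ)⁻¹ * E (ntr N (revWord M ++ M)) + (N : ℝ)⁻¹ * E (ntr N (M ++ M))) := by ring
      _ ≤ sv c * sv c * ((3 * b + 2 * (|L| * b')) * (N : ℝ)⁻¹) := by
        refine mul_le_mul_of_nonneg_left ?_ (mul_nonneg (hsv0 c) (hsv0 c))
        linarith
      _ ≤ B ^ 2 * ((3 * b + 2 * (|L| * b')) * (N : ℝ)⁻¹) :=
        mul_le_mul_of_nonneg_right (hB c c) (by positivity)
      _ = _ := by ring
  · simp only [hc, if_false]
    have h7 := mul_le_mul_of_nonneg_left ((le_abs_self _).trans h1) hN0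
    have h9 : 0 ≤ 2 * (|limTr v M| * b') := by positivity
    calc _ = sv c * sv c' * ((N : ℝ)⁻¹ * E (ntr N (revWord M ++ M))) := by ring
      _ ≤ sv c * sv c' * ((3 * b + 2 * (|limTr v M| * b')) * (N : ℝ)⁻¹) := by
        refine mul_le_mul_of_nonneg_left (h7.trans ?_) (mul_nonneg (hsv0 c) (hsv0 c'))
        rw [mul_comm]
        exact mul_le_mul_of_nonneg_right (by linarith) hN0
      _ ≤ B ^ 2 * ((3 * b + 2 * (|limTr v M| * b')) * (N : ℝ)⁻¹) :=
        mul_le_mul_of_nonneg_right (hB c c') (by positivity)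
      _ = _ := by ring

end QuadForm

/-! ### Gaussian moments and expectations of polynomials in the weights -/

theorem integrable_pow_gaussianReal (m : ℝ) (v : NNReal) (n : ℕ) :
    Integrable (fun x => x ^ n) (gaussianReal m v) := by
  have h : MemLp id (n : ENNReal) (gaussianReal m v) := memLp_id_gaussianReal' n (by simp)
  refine (integrable_norm_iff (continuous_pow n).aestronglyMeasurable).1 ?_
  simpa only [norm_pow] using! h.integrable_norm_pow'

/-- The recursion of the moments of a centered Gaussian law. -/
theorem integral_pow_succ_gaussianReal (v : NNReal) (n : ℕ) :
    ∫ x, x ^ (n + 1) ∂gaussianReal 0 v = v * (n * ∫ x, x ^ (n - 1) ∂gaussianReal 0 v) := by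
  by_cases hv : v = 0
  · simp [hv]
  have hv' : (v : ℝ) ≠ 0 := by simpa using hv
  have hint : ∀ k : ℕ, Integrable fun x => x ^ k * gaussianPDFReal 0 v x := by
    intro k
    have h := integrable_pow_gaussianReal 0 v k
    rw [gaussianReal_of_var_ne_zero _ hv, integrable_withDensity_iff_integrable_smul'
      (measurable_gaussianPDF _ _) (ae_of_all _ fun _ => gaussianPDF_lt_top)] at h
    simpa [toReal_gaussianPDF, mul_comm] using h
  have hderiv : ∀ x, HasDerivAt (gaussianPDFReal 0 v) (-(x / v) * gaussianPDFReal 0 v x) x := by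
    intro x
    have h1 : HasDerivAt (fun x : ℝ => -(x - 0) ^ 2 / (2 * v)) (-(x / v)) x := by
      have := ((((hasDerivAt_id x).sub_const 0).pow 2).neg).div_const (2 * (v : ℝ))
      convert! this using 1
      simp
      field_simp
    have h2 := h1.exp.const_mul ((√(2 * Real.pi * v))⁻¹)
    rw [gaussianPDFReal_def]
    convert! h2 using 1
    ring
  -- Integration by parts against the density, whose derivative is `-(x/v)` times itself. For `n =
  -- 0` the exponent `n - 1` is truncated, but comes with the factor `n`.
  have h := integral_mul_deriv_eq_deriv_mul_of_integrable (u := fun x : ℝ => x ^ n)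
    (u' := fun x : ℝ => n * x ^ (n - 1)) (v := gaussianPDFReal 0 v)
    (v' := fun x => -(x / v) * gaussianPDFReal 0 v x)
    (fun x _ => hasDerivAt_pow n x) (fun x _ => hderiv x) ?_ ?_ (hint n)
  · rw [integral_gaussianReal_eq_integral_smul hv, integral_gaussianReal_eq_integral_smul hv]
    have h1 : ∀ x : ℝ, x ^ n * (-(x / v) * gaussianPDFReal 0 v x) =
        -(v : ℝ)⁻¹ * (gaussianPDFReal 0 v x • x ^ (n + 1)) := fun x => by
      rw [smul_eq_mul]
      ring
    have h2 : ∀ x : ℝ, n * x ^ (n - 1) * gaussianPDFReal 0 v x =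
        n * (gaussianPDFReal 0 v x • x ^ (n - 1)) := fun x => by
      rw [smul_eq_mul]
      ring
    simp only [h1, h2, integral_const_mul] at h
    rw [neg_mul, neg_inj, inv_mul_eq_iff_eq_mul₀ hv'] at h
    exact h
  · refine ((hint (n + 1)).const_mul (-(v : ℝ)⁻¹)).congr (ae_of_all _ fun x => ?_)
    simp only [Pi.mul_apply]
    ring
  · refine ((hint (n - 1)).const_mul (n : ℝ)).congr (ae_of_all _ fun x => ?_)
    simp only [Pi.mul_apply]
    ring

section Expectation
variable {Ω : Type*} [MeasurableSpace Ω] {P : Measure Ω} {N d : ℕ} {σa σA σb : ℝ}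

/-- The variance of an entry. -/
def entryVar (σa σA σb : ℝ) (N d : ℕ) : Entry N d → ℝ
  | .inl _ => σa ^ 2
  | .inr (.inl _) => σA ^ 2 / N
  | .inr (.inr _) => σb ^ 2

theorem entryVar_nonneg (e : Entry N d) : 0 ≤ entryVar σa σA σb N d e := by
  rcases e with _ | _ | _ <;> simp only [entryVar] <;> positivity

theorem IsGaussianInit.hasLaw_entry {W : Ω → Weights N d} (hW : IsGaussianInit P σa σA σb W)
    (e : Entry N d) : HasLaw (fun ω => (W ω).entry e)
      (gaussianReal 0 (entryVar σa σA σb N d e).toNNReal) P := by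
  rcases e with α | ⟨k, α, β⟩ | ⟨k, α⟩
  · exact hW.law_a α
  · exact hW.law_A k α β
  · exact hW.law_b k α

/-- The evaluation of a polynomial at the entries of the weights. -/
def Weights.eval (W : Weights N d) : Poly N d →ₐ[ℝ] ℝ := MvPolynomial.aeval W.entry

theorem IsGaussianInit.memLp_eval [IsProbabilityMeasure P] {W : Ω → Weights N d}
    (hW : IsGaussianInit P σa σA σb W) (p : Poly N d) {q : ENNReal} (hq : q ≠ ⊤) :
    MemLp (fun ω => (W ω).eval p) q P := by
  -- The exponent is generalised because Hölder's inequality for a product doubles it.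
  induction p using MvPolynomial.induction_on generalizing q with
  | C a => simpa [Weights.eval] using memLp_const a
  | add p p' hp hp' => simpa using! (hp hq).add (hp' hq)
  | mul_X p e hp =>
    have hq2 : 2 * q ≠ ⊤ := ENNReal.mul_ne_top (by simp) hq
    have hX : MemLp (id ∘ fun ω => (W ω).entry e) (2 * q) P :=
      MemLp.comp_of_map ((hW.hasLaw_entry e).map_eq ▸ memLp_id_gaussianReal' (2 * q) hq2)
        (hW.hasLaw_entry e).aemeasurable
    have : ENNReal.HolderTriple (2 * q) (2 * q) q := ⟨by
      rw [ENNReal.mul_inv (by simp) (by simp), ← add_mul, ENNReal.inv_two_add_inv_two, one_mul]⟩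
    have := hX.mul (hp hq2) (r := q)
    simpa [Weights.eval] using! this

theorem IsGaussianInit.integrable_eval [IsProbabilityMeasure P] {W : Ω → Weights N d}
    (hW : IsGaussianInit P σa σA σb W) (p : Poly N d) :
    Integrable (fun ω => (W ω).eval p) P :=
  memLp_one_iff_integrable.1 (hW.memLp_eval p (by simp))

/-- The expectation of a polynomial in the entries. -/
def IsGaussianInit.expect [IsProbabilityMeasure P] {W : Ω → Weights N d}
    (hW : IsGaussianInit P σa σA σb W) : Poly N d →ₗ[ℝ] ℝ where
  toFun p := ∫ ω, (W ω).eval p ∂P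
  map_add' p q := by
    simp only [map_add]
    exact integral_add (hW.integrable_eval p) (hW.integrable_eval q)
  map_smul' c p := by
    simp only [map_smul, smul_eq_mul, integral_const_mul, RingHom.id_apply]

theorem IsGaussianInit.expect_apply [IsProbabilityMeasure P] {W : Ω → Weights N d}
    (hW : IsGaussianInit P σa σA σb W) (p : Poly N d) :
    hW.expect p = ∫ ω, (W ω).eval p ∂P :=
  rfl

theorem IsGaussianInit.expect_monomial [IsProbabilityMeasure P] {W : Ω → Weights N d}
    (hW : IsGaussianInit P σa σA σb W) (m : Entry N d →₀ ℕ) (a : ℝ) :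
    hW.expect (MvPolynomial.monomial m a) =
      a * ∏ e, ∫ x, x ^ m e ∂gaussianReal 0 (entryVar σa σA σb N d e).toNNReal := by
  have h : ∀ ω, (W ω).eval (MvPolynomial.monomial m a) = a * ∏ e, (W ω).entry e ^ m e :=
    fun ω => by
      rw [Weights.eval, MvPolynomial.aeval_monomial, Finsupp.prod_fintype _ _ (by simp)]
      rfl
  simp only [expect_apply, h, integral_const_mul]
  congr 1
  rw [hW.indep.integral_fun_prod_comp (f := fun e x => x ^ m e)
    (fun e => (hW.hasLaw_entry e).aemeasurable)
    (fun e => (continuous_pow _).aestronglyMeasurable)]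
  refine Finset.prod_congr rfl fun e _ => ?_
  rw [← (hW.hasLaw_entry e).map_eq, integral_map (hW.hasLaw_entry e).aemeasurable
    (continuous_pow _).aestronglyMeasurable]

/-- By linearity monomials suffice. Independence factorises their expectations, both sides differ
only in the exponent at `e`, and there the one-dimensional moment recursion applies. -/
theorem IsGaussianInit.isWick [IsProbabilityMeasure P] {W : Ω → Weights N d}
    (hW : IsGaussianInit P σa σA σb W) : IsWick hW.expect (entryVar σa σA σb N d) where
  map_one := by simp [expect_apply]
  stein e p := by
    induction p using MvPolynomial.induction_on' with
    | add p q hp hq => rw [mul_add, map_add, hp, hq, map_add, map_add, mul_add]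
    | monomial m a =>
      classical
      have hX : (MvPolynomial.X e * MvPolynomial.monomial m a : Poly N d) =
          MvPolynomial.monomial (Finsupp.single e 1 + m) a := by
        rw [MvPolynomial.X, MvPolynomial.monomial_mul, one_mul]
      have hsplit : ∀ m' : Entry N d →₀ ℕ, ∏ e', ∫ x, x ^ m' e' ∂gaussianReal 0
          (entryVar σa σA σb N d e').toNNReal =
          (∫ x, x ^ m' e ∂gaussianReal 0 (entryVar σa σA σb N d e).toNNReal) *
          ∏ e' ∈ Finset.univ.erase e, ∫ x, x ^ m' e' ∂gaussianReal 0
            (entryVar σa σA σb N d e').toNNReal := fun m' =>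
        (Finset.mul_prod_erase _ _ (Finset.mem_univ e)).symm
      rw [hX, MvPolynomial.pderiv_monomial, hW.expect_monomial, hW.expect_monomial, hsplit,
        hsplit (m - _)]
      have h1 : (Finsupp.single e 1 + m : Entry N d →₀ ℕ) e = m e + 1 := by simp [add_comm]
      have h2 : (m - Finsupp.single e 1 : Entry N d →₀ ℕ) e = m e - 1 := by simp
      have h3 : ∀ e' ∈ Finset.univ.erase e, (Finsupp.single e 1 + m : Entry N d →₀ ℕ) e' = m e' ∧
          (m - Finsupp.single e 1 : Entry N d →₀ ℕ) e' = m e' := fun e' he' => by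
        have := Finset.ne_of_mem_erase he'
        simp [this.symm]
      have h4 : ∏ e' ∈ Finset.univ.erase e, ∫ x, x ^ (Finsupp.single e 1 + m : Entry N d →₀ ℕ) e'
          ∂gaussianReal 0 (entryVar σa σA σb N d e').toNNReal =
          ∏ e' ∈ Finset.univ.erase e, ∫ x, x ^ (m - Finsupp.single e 1 : Entry N d →₀ ℕ) e'
          ∂gaussianReal 0 (entryVar σa σA σb N d e').toNNReal :=
        Finset.prod_congr rfl fun e' he' => by rw [(h3 e' he').1, (h3 e' he').2]
      rw [h1, h2, h4, integral_pow_succ_gaussianReal, Real.coe_toNNReal _ (entryVar_nonneg e)]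
      ring

end Expectation

/-! ### Square integrability of random series -/

/-- A pointwise convergent series whose terms have summable `L²` norms is square integrable. -/
theorem memLp_two_of_hasSum {Ω J : Type*} [MeasurableSpace Ω] {P : Measure Ω} [Countable J]
    {φ : J → Ω → ℝ} {F : Ω → ℝ} {β : J → ℝ} {ε : ℝ} (hφ : ∀ j, MemLp (φ j) 2 P)
    (hβ : ∀ j, 0 < β j) (hs : Summable β) (hε : 0 ≤ ε)
    (hb : ∀ j, ∫ ω, φ j ω ^ 2 ∂P ≤ β j ^ 2 * ε) (hF : ∀ ω, HasSum (fun j => φ j ω) (F ω)) :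
    MemLp F 2 P ∧ ∫ ω, F ω ^ 2 ∂P ≤ (∑' j, β j) ^ 2 * ε := by
  set B := ∑' j, β j with hB
  have hB0 : 0 ≤ B := tsum_nonneg fun j => (hβ j).le
  have hmeas : AEStronglyMeasurable F P :=
    aestronglyMeasurable_of_tendsto_ae (atTop : Filter (Finset J))
      (f := fun s ω => ∑ j ∈ s, φ j ω)
      (fun s => Finset.aestronglyMeasurable_fun_sum s fun j _ => (hφ j).1)
      (ae_of_all _ fun ω => hF ω)
  have hpt : ∀ ω, ENNReal.ofReal (F ω ^ 2) ≤
      ∑' j, ENNReal.ofReal (B * (φ j ω ^ 2 / β j)) := by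
    intro ω
    refine le_of_tendsto ((ENNReal.continuous_ofReal.tendsto _).comp ((hF ω).pow 2))
      (Eventually.of_forall fun s => ?_)
    -- Cauchy–Schwarz with weights `β j`. After integration each term `φ_j² / β_j` is at most `β_j
    -- ε`, so the total is `B · B ε`.
    have h1 : (∑ j ∈ s, φ j ω) ^ 2 ≤ (∑ j ∈ s, β j) * ∑ j ∈ s, φ j ω ^ 2 / β j :=
      Finset.sum_sq_le_sum_mul_sum_of_sq_le_mul s (fun j _ => (hβ j).le)
        (fun j _ => div_nonneg (sq_nonneg _) (hβ j).le)
        fun j _ => by rw [mul_div_cancel₀ _ (hβ j).ne']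
    have h2 : (∑ j ∈ s, φ j ω) ^ 2 ≤ ∑ j ∈ s, B * (φ j ω ^ 2 / β j) := by
      rw [← Finset.mul_sum]
      exact h1.trans (mul_le_mul_of_nonneg_right
        (hs.sum_le_tsum s fun j _ => (hβ j).le)
        (Finset.sum_nonneg fun j _ => div_nonneg (sq_nonneg _) (hβ j).le))
    refine (ENNReal.ofReal_le_ofReal h2).trans ?_
    rw [ENNReal.ofReal_sum_of_nonneg fun j _ =>
      mul_nonneg hB0 (div_nonneg (sq_nonneg _) (hβ j).le)]
    exact ENNReal.sum_le_tsum s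
  have hlint : ∫⁻ ω, ENNReal.ofReal (F ω ^ 2) ∂P ≤ ENNReal.ofReal (B ^ 2 * ε) := by
    calc ∫⁻ ω, ENNReal.ofReal (F ω ^ 2) ∂P
        ≤ ∫⁻ ω, ∑' j, ENNReal.ofReal (B * (φ j ω ^ 2 / β j)) ∂P := lintegral_mono hpt
      _ = ∑' j, ∫⁻ ω, ENNReal.ofReal (B * (φ j ω ^ 2 / β j)) ∂P :=
        lintegral_tsum fun j => ((((hφ j).1.aemeasurable.pow_const 2).div_const _).const_mul
          _).ennreal_ofReal
      _ ≤ ∑' j, ENNReal.ofReal (B * ε * β j) := by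
        refine ENNReal.tsum_le_tsum fun j => ?_
        rw [← ofReal_integral_eq_lintegral_ofReal (((hφ j).integrable_sq.div_const _).const_mul _)
          (ae_of_all _ fun ω => mul_nonneg hB0 (div_nonneg (sq_nonneg _) (hβ j).le)),
          integral_const_mul, integral_div]
        refine ENNReal.ofReal_le_ofReal ?_
        rw [mul_assoc]
        refine mul_le_mul_of_nonneg_left ?_ hB0
        rw [div_le_iff₀ (hβ j)]
        exact (hb j).trans_eq (by ring)
      _ = ENNReal.ofReal (B ^ 2 * ε) := by
        rw [← ENNReal.ofReal_tsum_of_nonneg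
          (fun j => mul_nonneg (mul_nonneg hB0 hε) (hβ j).le) (hs.mul_left _), tsum_mul_left,
          ← hB]
        congr 1
        ring
  have hint : Integrable (fun ω => F ω ^ 2) P := by
    refine ⟨hmeas.pow 2, ?_⟩
    rw [hasFiniteIntegral_iff_ofReal (ae_of_all _ fun ω => sq_nonneg _)]
    exact hlint.trans_lt ENNReal.ofReal_lt_top
  refine ⟨(memLp_two_iff_integrable_sq hmeas).2 hint, ?_⟩
  rw [integral_eq_lintegral_of_nonneg_ae (ae_of_all _ fun ω => sq_nonneg _) hint.1]
  exact ENNReal.toReal_le_of_le_ofReal (by positivity) hlint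

/-! ### The Gram matrix of the node vectors and its mean square error -/

section Gram
variable {N d : ℕ}

/-- The word of the product `A_vᵀ A_w`. -/
def pairWord (v w : List (Fin d)) : List (Letter d) :=
  revWord (v.map (·, false)) ++ w.map (·, false)

theorem length_pairWord (v w : List (Fin d)) : (pairWord v w).length = v.length + w.length := by
  simp [pairWord, length_revWord]

theorem limTr_pairWord (c : ℝ) (v w : List (Fin d)) :
    limTr c (pairWord v w) = if v = w then c ^ v.length else 0 := by
  have h := limTr_map_true_append_map_false c v.reverse w.reverse
  have h1 : pairWord v w =
      v.reverse.map (·, true) ++ (w.reverse.map (·, false)).reverse := by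
    simp [pairWord, revWord, Letter.flip, Function.comp_def]
  rw [h1, h]
  simp

theorem Weights.eval_letterMat_false (W : Weights N d) (k : Fin d) (i j : Fin N) :
    W.eval (letterMat N (k, false) i j) = W.A k i j := by
  simp [Weights.eval, letterMat, letterEntry, Weights.entry]

theorem Weights.eval_srcPoly (W : Weights N d) (c : Option (Fin d)) (i : Fin N) :
    W.eval (srcPoly c i) = W.src c i := by
  cases c <;> simp [Weights.eval, srcPoly, srcEntry, Weights.entry, Weights.src]

theorem Weights.nodeVec_apply (W : Weights N d) (w : List (Fin d)) (c : Option (Fin d))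
    (i : Fin N) :
    W.nodeVec w c i = ∑ j, W.eval (wordMat N (w.map (·, false)) i j) * W.src c j := by
  induction w generalizing i with
  | nil => simp [nodeVec, wordMat, Matrix.one_apply, apply_ite W.eval]
  | cons k w ih =>
    rw [nodeVec, op_apply]
    simp only [Matrix.mulVec, dotProduct, id, ih, List.map_cons, wordMat_cons, Matrix.mul_apply,
      map_sum, map_mul, eval_letterMat_false, Finset.sum_mul, Finset.mul_sum]
    rw [Finset.sum_comm]
    simp only [mul_assoc]

/-- Moving `A_v` to the other side of the inner product gives the bilinear form of `A_vᵀ A_w` at the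
two sources. -/
theorem Weights.eval_quadForm (W : Weights N d) (v w : List (Fin d)) (c c' : Option (Fin d)) :
    W.eval (quadForm N c (pairWord v w) c') =
      1 / (N : ℝ) * inner ℝ (W.nodeVec v c) (W.nodeVec w c') := by
  have hC : W.eval (MvPolynomial.C (N : ℝ)⁻¹) = (N : ℝ)⁻¹ := by simp [Weights.eval]
  rw [quadForm, map_mul, hC, one_div, PiLp.inner_apply]
  congr 1
  simp only [RCLike.inner_apply, conj_trivial, nodeVec_apply, map_sum, map_mul, eval_srcPoly,
    pairWord, wordMat_append, wordMat_revWord, Matrix.mul_apply, Matrix.transpose_apply,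
    Finset.mul_sum]
  rw [Finset.sum_congr rfl fun i _ => Finset.sum_comm, Finset.sum_comm]
  refine Finset.sum_congr rfl fun r _ => ?_
  rw [Finset.sum_congr rfl fun i _ => Finset.sum_mul _ _ _]
  refine Finset.sum_congr rfl fun i _ => Finset.sum_congr rfl fun j _ => ?_
  ring

end Gram

theorem factorial_add_le (p q : ℕ) :
    ((p + q).factorial : ℝ) ≤ 2 ^ (p + q) * (p.factorial * q.factorial) := by
  have h := Nat.add_choose_mul_factorial_mul_factorial p q
  have h2 := Nat.choose_le_two_pow (p + q) q
  rw [← h, mul_assoc]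
  exact_mod_cast Nat.mul_le_mul_right _ h2

/-- The polynomial growth in the lengths of the words of the error bound. -/
theorem three_mul_momBd_add_le {d : ℕ} {c : ℝ} (hc : 0 ≤ c) (v w : List (Fin d)) :
    3 * momBd c (2 * (pairWord v w).length) +
        2 * (|limTr c (pairWord v w)| * momBd c (pairWord v w).length) ≤
      5 * ((2 * (1 + 2 * c)) ^ v.length * v.length.factorial *
        ((2 * (1 + 2 * c)) ^ w.length * w.length.factorial)) := by
  -- The rate `2c` of `momBd_two_mul_le` is enlarged to `1 + 2c`, which stays positive even for `c =
  -- 0`; `devBound_pos` depends on this. It also dominates `c`, the rate of `limTr`. The constant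
  -- `5` is `3 + 2`.
  have key : ∀ m : ℕ, (2 * c) ^ m ≤ (1 + 2 * c) ^ m := fun m =>
    pow_le_pow_left₀ (by positivity) (by linarith) m
  have h1 : momBd c (2 * (v.length + w.length)) ≤
      (1 + 2 * c) ^ (v.length + w.length) * (v.length + w.length).factorial :=
    (momBd_two_mul_le hc _).trans (mul_le_mul_of_nonneg_right (key _) (by positivity))
  have h2 : |limTr c (pairWord v w)| * momBd c (v.length + w.length) ≤
      (1 + 2 * c) ^ (v.length + w.length) * (v.length + w.length).factorial := by
    rw [limTr_pairWord]
    split_ifs with h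
    · subst h
      rw [abs_of_nonneg (by positivity), ← two_mul]
      have h3 : momBd c (2 * v.length) ≤ (1 + 2 * c) ^ v.length * (2 * v.length).factorial :=
        (momBd_two_mul_le hc _).trans (mul_le_mul (key _)
          (mod_cast Nat.factorial_le (by omega)) (by positivity) (by positivity))
      have h4 : c ^ v.length ≤ (1 + 2 * c) ^ v.length :=
        pow_le_pow_left₀ hc (by linarith) _
      calc _ ≤ (1 + 2 * c) ^ v.length * ((1 + 2 * c) ^ v.length * (2 * v.length).factorial) :=
            mul_le_mul h4 h3 (momBd_nonneg hc _) (by positivity)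
        _ = _ := by ring
    · rw [abs_zero, zero_mul]
      positivity
  have h5 := mul_le_mul_of_nonneg_left (factorial_add_le v.length w.length)
    (show 0 ≤ (1 + 2 * c) ^ (v.length + w.length) by positivity)
  rw [length_pairWord]
  calc _ ≤ 5 * ((1 + 2 * c) ^ (v.length + w.length) * (v.length + w.length).factorial) := by
        linarith
    _ ≤ 5 * ((1 + 2 * c) ^ (v.length + w.length) *
        (2 ^ (v.length + w.length) * (v.length.factorial * w.length.factorial))) := by linarith
    _ = _ := by
      rw [mul_pow, mul_pow, pow_add, pow_add]
      ring

section MeanSquare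
variable {Ω : Type*} [MeasurableSpace Ω] {P : Measure Ω} [IsProbabilityMeasure P] {N d : ℕ}
  {σa σA σb : ℝ}

/-- The deviation of the Gram matrix of the node vectors from its limit. -/
def gramDev (σa σA σb : ℝ) (W : Weights N d) (p : Node d × Node d) : ℝ :=
  1 / (N : ℝ) * inner ℝ (W.nodeVec p.1.1 p.1.2) (W.nodeVec p.2.1 p.2.2) -
    if p.1 = p.2 then nodeVar σa σA σb p.1 else 0

/-- The polynomial whose evaluation is `gramDev`. -/
def gramPoly (N : ℕ) (σa σA σb : ℝ) (p : Node d × Node d) : Poly N d :=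
  quadForm N p.1.2 (pairWord p.1.1 p.2.1) p.2.2 - MvPolynomial.C
    (if p.1.2 = p.2.2 then srcVar σa σb p.1.2 * limTr (σA ^ 2) (pairWord p.1.1 p.2.1) else 0)

theorem eval_gramPoly (W : Weights N d) (p : Node d × Node d) :
    W.eval (gramPoly N σa σA σb p) = gramDev σa σA σb W p := by
  obtain ⟨⟨v, c⟩, w, c'⟩ := p
  have hC : ∀ a : ℝ, W.eval (MvPolynomial.C a) = a := fun a => by simp [Weights.eval]
  rw [gramPoly, gramDev, map_sub, W.eval_quadForm, hC, limTr_pairWord]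
  congr 1
  by_cases hc : c = c' <;> by_cases hv : v = w <;> simp [hc, hv, nodeVar, mul_comm]

theorem IsGaussianInit.integral_gramDev_sq_le {W : Ω → Weights N d}
    (hW : IsGaussianInit P σa σA σb W) (hN : N ≠ 0) (p : Node d × Node d) :
    ∫ ω, gramDev σa σA σb (W ω) p ^ 2 ∂P ≤
      (σa ^ 2 + σb ^ 2) ^ 2 *
        (5 * ((2 * (1 + 2 * σA ^ 2)) ^ p.1.1.length * p.1.1.length.factorial *
          ((2 * (1 + 2 * σA ^ 2)) ^ p.2.1.length * p.2.1.length.factorial))) * (N : ℝ)⁻¹ := by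
  have h := hW.isWick.map_quadForm_sub_sq_le hN (sq_nonneg σA) (sv := srcVar σa σb)
    (fun _ _ _ => div_eq_mul_inv _ _) (fun c i => by cases c <;> rfl) srcVar_nonneg srcVar_le
    p.1.2 p.2.2 (pairWord p.1.1 p.2.1)
  rw [hW.expect_apply] at h
  simp only [map_pow] at h
  have he : ∀ ω, gramDev σa σA σb (W ω) p = (W ω).eval (gramPoly N σa σA σb p) :=
    fun ω => (eval_gramPoly (W ω) p).symm
  simp only [he, gramPoly]
  refine h.trans ?_
  gcongr
  exact three_mul_momBd_add_le (sq_nonneg σA) _ _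

end MeanSquare

/-! ### Convergence in mean square -/

theorem tendsto_eLpNorm_two_of_integral_sq_le {Ω : Type*}
    [MeasurableSpace Ω] {P : Measure Ω} {f : ℕ → Ω → ℝ} {C : ℝ}
    (hf : ∀ N, N ≠ 0 → MemLp (f N) 2 P)
    (h : ∀ N, N ≠ 0 → ∫ ω, f N ω ^ 2 ∂P ≤ C / (N : ℝ)) :
    Tendsto (fun N => eLpNorm (f N) 2 P) atTop (𝓝 0) := by
  have hC : Tendsto (fun N : ℕ => ENNReal.ofReal ((C / (N : ℝ)) ^ (1 / 2 : ℝ))) atTop (𝓝 0) := by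
    have h1 := (tendsto_const_div_atTop_nhds_zero_nat C).rpow_const (p := 1 / 2)
      (Or.inr (by norm_num))
    rw [Real.zero_rpow (by norm_num)] at h1
    simpa using ENNReal.tendsto_ofReal h1
  refine tendsto_of_tendsto_of_tendsto_of_le_of_le' tendsto_const_nhds hC
    (Eventually.of_forall fun _ => bot_le) ?_
  filter_upwards [eventually_ne_atTop 0] with N hN
  rw [(hf N hN).eLpNorm_eq_integral_rpow_norm (by simp) (by simp)]
  refine ENNReal.ofReal_le_ofReal ?_
  simp only [ENNReal.toReal_ofNat, Real.rpow_two, Real.norm_eq_abs, sq_abs, one_div]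
  exact Real.rpow_le_rpow (integral_nonneg fun ω => sq_nonneg _) (h N hN) (by norm_num)

section Convergence
variable {Ω : Type*} [MeasurableSpace Ω] {P : Measure Ω} [IsProbabilityMeasure P] {N d : ℕ}
  {σa σA σb : ℝ}

theorem summable_norm_iterInt_smul_nodeVec (W : Weights N d) (x : PathSpace d) {s : ℝ}
    (hs : s ∈ Icc (0 : ℝ) 1) :
    Summable fun j : Node d => ‖iterInt (vel x) j.1 j.2 s • W.nodeVec j.1 j.2‖ :=
  (summable_sigBound (vel x) W).of_nonneg_of_le (fun _ => norm_nonneg _)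
    fun j => norm_iterInt_smul_nodeVec_le (integrable_vel x) W j hs

theorem hasSum_inner_prod {ι κ : Type*} {f : ι → EuclideanSpace ℝ (Fin N)}
    {g : κ → EuclideanSpace ℝ (Fin N)} {u v : EuclideanSpace ℝ (Fin N)} (hf : HasSum f u)
    (hg : HasSum g v) (hf' : Summable fun i => ‖f i‖) (hg' : Summable fun j => ‖g j‖) :
    HasSum (fun p : ι × κ => inner ℝ (f p.1) (g p.2)) (inner ℝ u v) := by
  have hs : Summable fun p : ι × κ => inner ℝ (f p.1) (g p.2) :=
    (hf'.mul_of_nonneg hg' (fun _ => norm_nonneg _) fun _ => norm_nonneg _).of_norm_bounded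
      fun p => norm_inner_le_norm _ _
  have h1 : HasSum (fun i => inner ℝ (f i) v) (inner ℝ u v) :=
    ((innerSL ℝ).flip v).hasSum hf
  have h2 : ∀ i, HasSum (fun j => inner ℝ (f i) (g j)) (inner ℝ (f i) v) := fun i =>
    (innerSL ℝ (f i)).hasSum hg
  rw [h1.unique (hs.hasSum.prod_fiberwise h2)]
  exact hs.hasSum

theorem hasSum_inner_randSig (W : Weights N d) (x y : PathSpace d) {s t : ℝ}
    (hs : s ∈ Icc (0 : ℝ) 1) (ht : t ∈ Icc (0 : ℝ) 1) :
    HasSum (fun p : Node d × Node d =>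
        iterInt (vel x) p.1.1 p.1.2 s * iterInt (vel y) p.2.1 p.2.2 t *
          inner ℝ (W.nodeVec p.1.1 p.1.2) (W.nodeVec p.2.1 p.2.2))
      (inner ℝ (randSig id W x s) (randSig id W y t)) := by
  have h := hasSum_inner_prod (hasSum_randSig W x hs) (hasSum_randSig W y ht)
    (summable_norm_iterInt_smul_nodeVec W x hs) (summable_norm_iterInt_smul_nodeVec W y ht)
  simp only [real_inner_smul_left, real_inner_smul_right] at h
  exact h.congr fun p => Finset.sum_congr rfl fun q _ => by ring

theorem hasSum_gramDev (W : Weights N d) (x y : PathSpace d) {s t : ℝ}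
    (hs : s ∈ Icc (0 : ℝ) 1) (ht : t ∈ Icc (0 : ℝ) 1) :
    HasSum (fun p : Node d × Node d =>
        iterInt (vel x) p.1.1 p.1.2 s * iterInt (vel y) p.2.1 p.2.2 t *
          gramDev σa σA σb W p)
      (1 / (N : ℝ) * inner ℝ (randSig id W x s) (randSig id W y t) -
        neuralSigKernel id σa σA σb x y s t) := by
  -- The kernel series is read as a double series supported on the diagonal, so that it can be
  -- subtracted term by term.
  have hdiag : HasSum (fun p : Node d × Node d =>
      iterInt (vel x) p.1.1 p.1.2 s * iterInt (vel y) p.2.1 p.2.2 t *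
        if p.1 = p.2 then nodeVar σa σA σb p.1 else 0) (neuralSigKernel id σa σA σb x y s t) := by
    have hinj : Function.Injective fun j : Node d => (j, j) := fun j j' h => congrArg Prod.fst h
    rw [← hinj.hasSum_iff]
    · convert hasSum_neuralSigKernel x y hs ht using 1
      funext j
      simp only [Function.comp, if_true]
      ring
    · rintro ⟨j, j'⟩ hj
      rw [if_neg, mul_zero]
      intro h
      exact hj ⟨j, Prod.ext rfl h⟩
  have h := ((hasSum_inner_randSig W x y hs ht).mul_left (1 / (N : ℝ))).sub hdiag
  refine h.congr fun p => Finset.sum_congr rfl fun q _ => ?_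
  simp only [gramDev]
  ring

/-- The growth rate of the error bounds of the terms of the expansion. -/
def devBound (σA : ℝ) (u : Fin d → ℝ → ℝ) (j : Node d) : ℝ :=
  (1 + len u) * (((1 + len u) * √(2 * (1 + 2 * σA ^ 2))) ^ j.1.length /
    √(j.1.length.factorial : ℝ))

theorem devBound_pos (u : Fin d → ℝ → ℝ) (j : Node d) : 0 < devBound σA u j := by
  have := len_nonneg u
  unfold devBound
  positivity

theorem summable_devBound (u : Fin d → ℝ → ℝ) : Summable (devBound (d := d) σA u) := by
  have := len_nonneg u
  exact (summable_pow_div_sqrt_factorial_node d (by positivity)).mul_left _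

/-- The squared integral has `1/(n!)²` against the `n!` of the second moment, which leaves `1/n!`,
the square of the decay in `devBound`. Using `1 + len u` for the length keeps the weights strictly
positive, since `memLp_two_of_hasSum` divides by them. -/
theorem iterInt_sq_mul_le {u : Fin d → ℝ → ℝ} (hu : ∀ k, Integrable (u k)) (j : Node d) {t : ℝ}
    (ht : t ∈ Icc (0 : ℝ) 1) :
    iterInt u j.1 j.2 t ^ 2 * ((2 * (1 + 2 * σA ^ 2)) ^ j.1.length * j.1.length.factorial) ≤
      devBound σA u j ^ 2 := by
  have hl := len_nonneg u
  have hf : (0 : ℝ) < j.1.length.factorial := by positivity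
  have h1 : |iterInt u j.1 j.2 t| ≤
      (1 + len u) * ((1 + len u) ^ j.1.length / j.1.length.factorial) := by
    refine (abs_iterInt_le hu j.1 j.2 ht).trans ?_
    gcongr
    linarith
  rw [← sq_abs]
  refine (mul_le_mul_of_nonneg_right (pow_le_pow_left₀ (abs_nonneg _) h1 2)
    (by positivity)).trans_eq ?_
  rw [devBound, mul_pow (1 + len u), mul_pow (1 + len u), div_pow, div_pow, Real.sq_sqrt hf.le,
    mul_pow (1 + len u), mul_pow (_ ^ _) (_ ^ _), ← pow_mul √_, mul_comm j.1.length 2,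
    pow_mul √_, Real.sq_sqrt (by positivity)]
  field_simp

theorem memLp_gramDev {W : Ω → Weights N d} (hW : IsGaussianInit P σa σA σb W)
    (p : Node d × Node d) : MemLp (fun ω => gramDev σa σA σb (W ω) p) 2 P := by
  simp only [← eval_gramPoly]
  exact hW.memLp_eval _ (by simp)

/-- The mean square error of the Gram matrix of the randomized signature. -/
theorem IsGaussianInit.memLp_and_integral_sq_le {W : Ω → Weights N d}
    (hW : IsGaussianInit P σa σA σb W) (hN : N ≠ 0) (x y : PathSpace d) {s t : ℝ}
    (hs : s ∈ Icc (0 : ℝ) 1) (ht : t ∈ Icc (0 : ℝ) 1) :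
    MemLp (fun ω => 1 / (N : ℝ) * inner ℝ (randSig id (W ω) x s) (randSig id (W ω) y t) -
      neuralSigKernel id σa σA σb x y s t) 2 P ∧
    ∫ ω, (1 / (N : ℝ) * inner ℝ (randSig id (W ω) x s) (randSig id (W ω) y t) -
      neuralSigKernel id σa σA σb x y s t) ^ 2 ∂P ≤
      (∑' p : Node d × Node d, devBound σA (vel x) p.1 * devBound σA (vel y) p.2) ^ 2 *
        ((σa ^ 2 + σb ^ 2) ^ 2 * 5 * (N : ℝ)⁻¹) := by
  refine memLp_two_of_hasSum (fun p => (memLp_gramDev hW p).const_mul _)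
    (fun p => mul_pos (devBound_pos _ _) (devBound_pos _ _))
    ((summable_devBound (vel x)).mul_of_nonneg (summable_devBound (vel y))
      (fun j => (devBound_pos _ _).le) fun j => (devBound_pos _ _).le) (by positivity)
    (fun p => ?_) fun ω => hasSum_gramDev (W ω) x y hs ht
  have hx := iterInt_sq_mul_le (σA := σA) (integrable_vel x) p.1 hs
  have hy := iterInt_sq_mul_le (σA := σA) (integrable_vel y) p.2 ht
  simp only [mul_pow, integral_const_mul]
  have h := hW.integral_gramDev_sq_le hN p
  calc _ ≤ iterInt (vel x) p.1.1 p.1.2 s ^ 2 * iterInt (vel y) p.2.1 p.2.2 t ^ 2 * _ :=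
        mul_le_mul_of_nonneg_left h (by positivity)
    _ = (iterInt (vel x) p.1.1 p.1.2 s ^ 2 *
          ((2 * (1 + 2 * σA ^ 2)) ^ p.1.1.length * p.1.1.length.factorial)) *
        (iterInt (vel y) p.2.1 p.2.2 t ^ 2 *
          ((2 * (1 + 2 * σA ^ 2)) ^ p.2.1.length * p.2.1.length.factorial)) *
        ((σa ^ 2 + σb ^ 2) ^ 2 * 5 * (N : ℝ)⁻¹) := by ring
    _ ≤ _ := mul_le_mul_of_nonneg_right (mul_le_mul hx hy (by positivity) (by positivity))
        (by positivity)

end Convergence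

end

end NeuralSig

theorem mainTheorem9 {Ω : Type*} [MeasurableSpace Ω] (P : Measure Ω) [IsProbabilityMeasure P]
    (d : ℕ) (σa σA σb : ℝ) (hσa : 0 < σa) (hσA : 0 < σA) (hσb : 0 ≤ σb)
    (W : (N : ℕ) → Ω → NeuralSig.Weights N d)
    (hW : ∀ N, NeuralSig.IsGaussianInit P σa σA σb (W N)) :
    -- the neural CDE with `φ = id` is well posed, and `randSig` is its unique solution
    (∀ (N : ℕ) (w : NeuralSig.Weights N d) (x : NeuralSig.PathSpace d),
      NeuralSig.IsNeuralCDESol id w x (NeuralSig.randSig id w x) ∧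
      ∀ S, NeuralSig.IsNeuralCDESol id w x S →
        EqOn S (NeuralSig.randSig id w x) (Icc 0 1)) ∧
    -- the equation of `𝒦_id` is well posed, and `neuralSigKernel` is its unique solution
    (NeuralSig.IsNeuralSigKernel (d := d) id σa σA σb
        (NeuralSig.neuralSigKernel id σa σA σb) ∧
      ∀ K : NeuralSig.PathSpace d → NeuralSig.PathSpace d → ℝ → ℝ → ℝ,
        NeuralSig.IsNeuralSigKernel id σa σA σb K →
        ∀ x y, ∀ s ∈ Icc (0 : ℝ) 1, ∀ t ∈ Icc (0 : ℝ) 1,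
          K x y s t = NeuralSig.neuralSigKernel id σa σA σb x y s t) ∧
    -- convergence in `L²`, with mean square error of order `1 / N`
    ∀ (x y : NeuralSig.PathSpace d), ∀ s ∈ Icc (0 : ℝ) 1, ∀ t ∈ Icc (0 : ℝ) 1,
      (∀ N : ℕ, MemLp (fun ω => (1 / (N : ℝ)) *
        inner ℝ (NeuralSig.randSig id (W N ω) x s) (NeuralSig.randSig id (W N ω) y t)) 2 P) ∧
      Tendsto (fun N : ℕ => eLpNorm (fun ω => (1 / (N : ℝ)) *
          inner ℝ (NeuralSig.randSig id (W N ω) x s) (NeuralSig.randSig id (W N ω) y t)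
          - NeuralSig.neuralSigKernel id σa σA σb x y s t) 2 P) atTop (𝓝 0) ∧
      ∃ C : ℝ, ∀ N : ℕ, 0 < N →
        ∫ ω, ((1 / (N : ℝ)) *
          inner ℝ (NeuralSig.randSig id (W N ω) x s) (NeuralSig.randSig id (W N ω) y t)
          - NeuralSig.neuralSigKernel id σa σA σb x y s t) ^ 2 ∂P ≤ C / (N : ℝ) := by
  refine ⟨fun N w x => ⟨NeuralSig.isNeuralCDESol_randSig w x,
      fun S hS => hS.eqOn (NeuralSig.isNeuralCDESol_randSig w x)⟩,
    ⟨NeuralSig.isNeuralSigKernel_neuralSigKernel, fun K hK x y s hs t ht =>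
      hK.eq_of_id NeuralSig.isNeuralSigKernel_neuralSigKernel x y hs ht⟩,
    fun x y s hs t ht => ?_⟩
  have key := fun (N : ℕ) (hN : N ≠ 0) => (hW N).memLp_and_integral_sq_le hN x y hs ht
  set C := (∑' p : NeuralSig.Node d × NeuralSig.Node d, NeuralSig.devBound σA (NeuralSig.vel x) p.1 *
    NeuralSig.devBound σA (NeuralSig.vel y) p.2) ^ 2 * ((σa ^ 2 + σb ^ 2) ^ 2 * 5)
  have hC : ∀ N : ℕ, N ≠ 0 → _ ≤ C / (N : ℝ) := fun N hN =>
    (key N hN).2.trans_eq (by rw [div_eq_mul_inv, ← mul_assoc])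
  refine ⟨fun N => ?_, NeuralSig.tendsto_eLpNorm_two_of_integral_sq_le
    (fun N hN => (key N hN).1) hC, C, fun N hN => hC N hN.ne'⟩
  -- For `N = 0` the convention `1 / 0 = 0` makes the variable vanish.
  rcases eq_or_ne N 0 with rfl | hN
  · simp
  · convert (key N hN).1.add (memLp_const (NeuralSig.neuralSigKernel id σa σA σb x y s t)) using 1
    ext ω
    exact (sub_add_cancel _ _).symm
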